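/- Let $m\ge 1$, $N\ge 0$ and $n_1,\dots,n_N\ge 1$ be integers. Then there is a constant $C$, depending only on $m$, $N$ and $n_1,\dots,n_N$, such that for every finite field $\mathbb F$, with $t:=1/|\mathbb F|$, the following holds. If a tuple $(D_1,\dots,D_N)$ is drawn uniformly at random from the finite set $X$ of all $N$-tuples of matrices $D_i\in\mathbb F[z]^{m\times m}$ in Hermite form with $\deg(\det D_i)=n_i$ for $i=1,\dots,N$, then $$\left|\Pr\bigl(D_i \text{ and } D_j \text{ are left coprime for all } i\ne j\bigr)-\Bigl(1-\frac{N(N-1)}{2}\,t^m\Bigr)\right|\le C\,t^{m+1},$$ that is, the probability that $D_1,\dots,D_N$ are pairwise left coprime is $1-\frac{N(N-1)}{2}t^m+O(t^{m+1})$ as $|\mathbb F|\to\infty$. Here $Q\in\mathbb F[z]^{m\times m}$ is in Hermite form if it is lower triangular, its diagonal entries $q_{ii}$ are monic, and $\deg q_{ij}<\deg q_{ii}$ for $1\le j<i\le m$ (with $\deg 0=-\infty$). Matrices $A,B\in\mathbb F[z]^{m\times m}$ are left coprime if they have a greatest common left divisor $H$ with $HY=I_m$ for some polynomial matrix $Y$;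 here a common left divisor of $A$ and $B$ is a polynomial matrix $H$ with $m$ rows and any number of columns such that $A=HY_1$ and $B=HY_2$ for polynomial matrices $Y_1,Y_2$, and it is a greatest one if every common left divisor $G$ of $A$ and $B$ satisfies $H=GS$ for some polynomial matrix $S$. -/

import Mathlib

open Polynomial

/-- `H` (with any number `k` of columns) is a common left divisor of the polynomial matrices
`A i ∈ F[z]^{p × c i}`: each `A i` is of the form `H * Y` with a polynomial matrix `Y`. -/
def IsCommonLeftDivisor {F : Type*} [Field F] {ι : Type*} {p : ℕ} {c : ι → ℕ}
    (A : (i : ι) → Matrix (Fin p) (Fin (c i)) F[X]) {k : ℕ}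
    (H : Matrix (Fin p) (Fin k) F[X]) : Prop :=
  ∀ i, ∃ Y : Matrix (Fin k) (Fin (c i)) F[X], A i = H * Y

/-- `H` is a greatest common left divisor of the family `A`: it is a common left divisor, and
every common left divisor (with any number of columns) is a left divisor of `H`. -/
def IsGreatestCommonLeftDivisor {F : Type*} [Field F] {ι : Type*} {p : ℕ} {c : ι → ℕ}
    (A : (i : ι) → Matrix (Fin p) (Fin (c i)) F[X]) {k : ℕ}
    (H : Matrix (Fin p) (Fin k) F[X]) : Prop :=
  IsCommonLeftDivisor A H ∧
    ∀ (l : ℕ) (G : Matrix (Fin p) (Fin l) F[X]), IsCommonLeftDivisor A G →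
      ∃ S : Matrix (Fin l) (Fin k) F[X], H = G * S

/-- The family `A` is left coprime: a greatest common left divisor of it has a polynomial
right inverse. (Greatest common left divisors are left divisors of each other, so that it does
not matter which one is taken.) -/
def LeftCoprime {F : Type*} [Field F] {ι : Type*} {p : ℕ} {c : ι → ℕ}
    (A : (i : ι) → Matrix (Fin p) (Fin (c i)) F[X]) : Prop :=
  ∃ (k : ℕ) (H : Matrix (Fin p) (Fin k) F[X]), IsGreatestCommonLeftDivisor A H ∧
    ∃ Y : Matrix (Fin k) (Fin p) F[X], H * Y = 1

/-- Any two members (with different indices) of the family `D` are left coprime. -/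
def PairwiseLeftCoprime {F : Type*} [Field F] {N m : ℕ}
    (D : Fin N → Matrix (Fin m) (Fin m) F[X]) : Prop :=
  ∀ i j : Fin N, i ≠ j → LeftCoprime (c := fun _ : Fin 2 => m) ![D i, D j]

/-- `Q` is in Hermite form: lower triangular with monic diagonal entries, each entry to the left
of the diagonal having degree smaller than the diagonal entry of its row. Here the zero
polynomial has degree `⊥`, so next to a diagonal entry `1` all entries of the row vanish. -/
structure IsHermiteForm {F : Type*} [Field F] {m : ℕ} (Q : Matrix (Fin m) (Fin m) F[X]) :
    Prop where
  upper_eq_zero : ∀ i j, i < j → Q i j = 0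
  monic_diag : ∀ i, (Q i i).Monic
  degree_lt : ∀ i j, j < i → (Q i j).degree < (Q i i).degree

/-- The set of all tuples of `m × m` matrices `D i` over `F[z]` in Hermite form such that
`det (D i)` has degree `n i`. -/
def hermiteTuples (F : Type*) [Field F] (m : ℕ) {N : ℕ} (n : Fin N → ℕ) :
    Set (Fin N → Matrix (Fin m) (Fin m) F[X]) :=
  {D | ∀ i, IsHermiteForm (D i) ∧ (D i).det.natDegree = n i}

/-- The probability of `S` under the uniform distribution on the finite nonempty set `X`. -/
noncomputable def uniformProb {α : Type*} (X S : Set α) : ℝ :=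
  ((X ∩ S).ncard : ℝ) / (X.ncard : ℝ)

theorem IsHermiteForm.det_natDegree {F : Type*} [Field F] {m : ℕ}
    {Q : Matrix (Fin m) (Fin m) F[X]} (h : IsHermiteForm Q) :
    Q.det.natDegree = ∑ i, (Q i i).natDegree := by
  rw [Matrix.det_of_isLowerTriangular Q (fun i j hij => h.upper_eq_zero i j hij),
    natDegree_prod_of_monic _ _ (fun i _ => h.monic_diag i)]

theorem hermiteTuples_finite (F : Type*) [Field F] [Finite F] (m : ℕ) {N : ℕ} (n : Fin N → ℕ) :
    (hermiteTuples F m n).Finite := by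
  have hfin : ∀ k : ℕ, ((degreeLT F k : Submodule F F[X]) : Set F[X]).Finite := fun k =>
    
    Set.finite_coe_iff.1 (Finite.of_equiv _ (degreeLTEquiv F k).symm.toEquiv)
  refine (Set.Finite.pi' (fun i => Set.Finite.pi' (fun _ : Fin m =>
    Set.Finite.pi' (fun _ : Fin m => hfin (n i + 1))))).subset ?_
  intro D hD i a b
  obtain ⟨h, hd⟩ := hD i
  rw [h.det_natDegree] at hd
  have hle : (D i a a).natDegree ≤ n i :=
    hd ▸ Finset.single_le_sum (f := fun a => (D i a a).natDegree) (fun _ _ => Nat.zero_le _)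
      (Finset.mem_univ a)
  have hdeg : (D i a a).degree < ((n i + 1 : ℕ) : WithBot ℕ) :=
    lt_of_le_of_lt (degree_le_of_natDegree_le hle) (by exact_mod_cast Nat.lt_succ_self _)
  show D i a b ∈ degreeLT F (n i + 1)
  rw [mem_degreeLT]
  rcases lt_trichotomy a b with hab | rfl | hab
  · rw [h.upper_eq_zero a b hab, degree_zero]
    exact WithBot.bot_lt_coe _
  · exact hdeg
  · exact (h.degree_lt a b hab).trans hdeg

theorem hermiteTuples_nonempty (F : Type*) [Field F] {m : ℕ} (hm : 1 ≤ m) {N : ℕ}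
    (n : Fin N → ℕ) : (hermiteTuples F m n).Nonempty := by
  let z : Fin m := ⟨0, hm⟩
  have hh : ∀ i, IsHermiteForm
      (Matrix.diagonal (fun a : Fin m => if a = z then (X : F[X]) ^ n i else 1)) := by
    intro i
    have hmon : ∀ a : Fin m, (if a = z then (X : F[X]) ^ n i else 1).Monic := by
      intro a
      split_ifs
      · exact monic_X_pow _
      · exact monic_one
    refine ⟨fun a b hab => Matrix.diagonal_apply_ne _ hab.ne, fun a => ?_, fun a b hab => ?_⟩
    · rw [Matrix.diagonal_apply_eq]
      exact hmon a
    · rw [Matrix.diagonal_apply_ne _ hab.ne', Matrix.diagonal_apply_eq, degree_zero]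
      exact bot_lt_iff_ne_bot.2 (degree_ne_bot.2 (hmon a).ne_zero)
  refine ⟨fun i => Matrix.diagonal (fun a => if a = z then X ^ n i else 1), fun i => ⟨hh i, ?_⟩⟩
  rw [(hh i).det_natDegree, Finset.sum_eq_single z]
  · simp
  · intro a _ ha
    simp [ha]
  · simp

/-! A nonsingular matrix is studied through its column module `L ⊆ F[X]^m`. Each column module of a
nonsingular matrix has exactly one Hermite basis, and `D`, `E` are left coprime iff their column
modules add up to `F[X]^m`. Write `q = |F|` and let `h n` be the number of Hermite forms with
determinant of degree `n`.

Counting single matrices: diagonal degrees `κ i` (indices from 0) leave `q ^ ∑ κ i * (i + 1)`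
Hermite forms. The exponent is largest, namely `m * n`, only when the last diagonal entry carries
the whole degree, so `h n = q ^ (m * n) * (1 + O(t))`.

Counting pairs: if `D`, `E` are not coprime, the Hermite basis `G` of the sum of their column
modules is a common left divisor of some degree `d ≥ 1`. Left multiplication by `G` is, up to normal
form, a bijection from Hermite forms of degree `n - d` onto those of degree `n` divisible by `G`.
Hence at most `∑ h d * h (a - d) * h (b - d)` pairs are not coprime, a proportion of order `t ^ (m *
d)` for each `d`. The term `d = 1` gives `t ^ m`. Conversely, `G` of degree 1 times a coprime pair
of degrees `a - 1`, `b - 1` determines `G` and the pair, and almost all pairs are coprime, which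
gives the matching lower bound.

Passing to `N` matrices: by Bonferroni it remains to bound the probability that two different index
pairs both fail. One index of the second pair is absent from the first; with all other matrices
fixed, resampling that one fails with probability `O(t)`, uniformly in the fixed matrices. So each
joint probability is `O(t ^ (m + 1))`. The lemmas that carry this are `le_nonCoprime_prob`,
`nonCoprime_prob_le`, `nonCoprime_fiber_le` and `abs_prob_pairwise_sub_le`. -/

/-- The submodule spanned by the columns of a polynomial matrix. -/
noncomputable def colModule {F : Type*} [Field F] {m k : ℕ} (D : Matrix (Fin m) (Fin k) F[X]) :
    Submodule F[X] (Fin m → F[X]) :=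
  LinearMap.range D.mulVecLin

/-! ### Column modules, Hermite normal forms and left coprimeness. -/

section Algebra

variable {F : Type*} [Field F] {m : ℕ}

theorem mem_colModule {k : ℕ} {D : Matrix (Fin m) (Fin k) F[X]} {w : Fin m → F[X]} :
    w ∈ colModule D ↔ ∃ u, D.mulVec u = w := Iff.rfl

theorem col_mem_colModule {k : ℕ} (D : Matrix (Fin m) (Fin k) F[X]) (j : Fin k) :
    (fun i => D i j) ∈ colModule D :=
  ⟨Pi.single j 1, by ext i; simp⟩

theorem colModule_mul {k l : ℕ} (G : Matrix (Fin m) (Fin k) F[X])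
    (Y : Matrix (Fin k) (Fin l) F[X]) :
    colModule (G * Y) = (colModule Y).map G.mulVecLin := by
  rw [colModule, colModule, Matrix.mulVecLin_mul, LinearMap.range_comp]

theorem colModule_mul_le {k l : ℕ} (G : Matrix (Fin m) (Fin k) F[X])
    (Y : Matrix (Fin k) (Fin l) F[X]) : colModule (G * Y) ≤ colModule G := by
  rw [colModule_mul]
  exact LinearMap.map_le_range

theorem colModule_one : colModule (1 : Matrix (Fin m) (Fin m) F[X]) = ⊤ := by
  rw [colModule, Matrix.mulVecLin_one, LinearMap.range_id]

theorem colModule_le_iff {k l : ℕ} {D : Matrix (Fin m) (Fin l) F[X]}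
    {G : Matrix (Fin m) (Fin k) F[X]} : colModule D ≤ colModule G ↔
      ∃ Y : Matrix (Fin k) (Fin l) F[X], D = G * Y := by
  constructor
  · intro h
    choose u hu using fun j => mem_colModule.1 (h (col_mem_colModule D j))
    refine ⟨fun a b => u b a, ?_⟩
    ext i j : 2
    have := congrFun (hu j) i
    rw [← this]
    rfl
  · rintro ⟨Y, rfl⟩
    exact colModule_mul_le G Y

theorem det_smul_mem_colModule (D : Matrix (Fin m) (Fin m) F[X]) (v : Fin m → F[X]) :
    D.det • v ∈ colModule D := by
  refine ⟨D.adjugate.mulVec v, ?_⟩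
  rw [Matrix.mulVecLin_apply, Matrix.mulVec_mulVec, Matrix.mul_adjugate, Matrix.smul_mulVec,
    Matrix.one_mulVec]

theorem mulVecLin_injective_of_det_ne_zero {G : Matrix (Fin m) (Fin m) F[X]} (hG : G.det ≠ 0) :
    Function.Injective G.mulVecLin := by
  rw [← LinearMap.ker_eq_bot, LinearMap.ker_eq_bot']
  intro v hv
  exact Matrix.eq_zero_of_mulVec_eq_zero hG hv

theorem natDegree_det_eq_of_colModule_eq {D G : Matrix (Fin m) (Fin m) F[X]}
    (h : colModule D = colModule G) : D.det.natDegree = G.det.natDegree := by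
  obtain ⟨Y, hY⟩ := colModule_le_iff.1 h.le
  obtain ⟨Z, hZ⟩ := colModule_le_iff.1 h.ge
  have h1 : G.det ∣ D.det := ⟨Y.det, by rw [← Matrix.det_mul, ← hY]⟩
  have h2 : D.det ∣ G.det := ⟨Z.det, by rw [← Matrix.det_mul, ← hZ]⟩
  exact natDegree_eq_of_degree_eq (degree_eq_degree_of_associated (associated_of_dvd_dvd h2 h1))

theorem IsHermiteForm.det_monic {Q : Matrix (Fin m) (Fin m) F[X]} (h : IsHermiteForm Q) :
    Q.det.Monic := by
  rw [Matrix.det_of_isLowerTriangular Q (fun i j hij => h.upper_eq_zero i j hij)]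
  exact monic_prod_of_monic _ _ fun i _ => h.monic_diag i

theorem IsHermiteForm.det_ne_zero {Q : Matrix (Fin m) (Fin m) F[X]} (h : IsHermiteForm Q) :
    Q.det ≠ 0 := h.det_monic.ne_zero

/-- In a vector of the column module of a Hermite form, the first entry that may be nonzero is
divisible by the corresponding diagonal entry. -/
theorem IsHermiteForm.diag_dvd {Q : Matrix (Fin m) (Fin m) F[X]} (h : IsHermiteForm Q)
    {w : Fin m → F[X]} (hw : w ∈ colModule Q) (j : Fin m) (h0 : ∀ k < j, w k = 0) :
    Q j j ∣ w j := by
  obtain ⟨u, rfl⟩ := mem_colModule.1 hw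
  -- By triangularity, row `i` sees only `u k` with `k ≤ i`; once the earlier ones vanish, a single
  -- product remains.
  have key : ∀ i, (∀ k < i, u k = 0) → Q.mulVec u i = Q i i * u i := by
    intro i hi
    rw [Matrix.mulVec, dotProduct]
    refine Finset.sum_eq_single i (fun b _ hb => ?_) (by simp)
    rcases lt_or_gt_of_ne hb with hb | hb
    · rw [hi b hb, mul_zero]
    · rw [h.upper_eq_zero i b hb, zero_mul]
  have hu : ∀ k < j, u k = 0 := by
    intro k
    induction k using WellFoundedLT.induction with
    | ind k ih =>
      intro hk
      have h1 := key k fun l hl => ih l hl (hl.trans hk)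
      rw [h0 k hk] at h1
      exact (mul_eq_zero.1 h1.symm).resolve_left (h.monic_diag k).ne_zero
  exact ⟨u j, key j hu⟩

/-- The diagonal entries divide each other and are monic, hence agree. The difference of two
corresponding columns lies in the common module, and its entries below the diagonal have degree less
than the pivots that must divide them, so they vanish one after another. -/
theorem IsHermiteForm.eq_of_colModule_eq {Q Q' : Matrix (Fin m) (Fin m) F[X]}
    (h : IsHermiteForm Q) (h' : IsHermiteForm Q') (heq : colModule Q = colModule Q') :
    Q = Q' := by
  have hd : ∀ j, Q j j = Q' j j := by
    intro j
    refine eq_of_monic_of_associated (h.monic_diag j) (h'.monic_diag j)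
      (associated_of_dvd_dvd ?_ ?_)
    · exact h.diag_dvd (w := fun i => Q' i j) (heq ▸ col_mem_colModule Q' j) j
        fun k hk => h'.upper_eq_zero k j hk
    · exact h'.diag_dvd (w := fun i => Q i j) (heq ▸ col_mem_colModule Q j) j
        fun k hk => h.upper_eq_zero k j hk
  refine Matrix.ext fun i j => ?_
  have hw : (fun i => Q i j) - (fun i => Q' i j) ∈ colModule Q :=
    Submodule.sub_mem _ (col_mem_colModule Q j) (heq ▸ col_mem_colModule Q' j)
  have hz : ∀ i, ((fun i => Q i j) - (fun i => Q' i j)) i = 0 := by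
    intro i
    induction i using WellFoundedLT.induction with
    | ind i ih =>
      rcases lt_trichotomy i j with hij | rfl | hij
      · simp [h.upper_eq_zero i j hij, h'.upper_eq_zero i j hij]
      · simp [hd i]
      · refine eq_zero_of_dvd_of_degree_lt (h.diag_dvd hw i ih) ?_
        refine (degree_sub_le _ _).trans_lt (max_lt (h.degree_lt i j hij) ?_)
        rw [hd i]
        exact h'.degree_lt i j hij
  exact sub_eq_zero.1 (hz i)

/-- The vectors of a submodule of `F[X]^m` whose entries before the `j`-th one vanish contain one
with a monic `j`-th entry that divides all others. -/
theorem exists_pivot {L : Submodule F[X] (Fin m → F[X])} {f : F[X]} (hf : f ≠ 0)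
    (hL : ∀ v : Fin m → F[X], f • v ∈ L) (j : Fin m) :
    ∃ v ∈ L, (∀ k < j, v k = 0) ∧ (v j).Monic ∧
      ∀ w ∈ L, (∀ k < j, w k = 0) → v j ∣ w j := by
  classical
  let P : Submodule F[X] (Fin m → F[X]) :=
    { carrier := {w | w ∈ L ∧ ∀ k < j, w k = 0}
      add_mem' := fun ha hb => ⟨L.add_mem ha.1 hb.1, fun k hk => by
        rw [Pi.add_apply, ha.2 k hk, hb.2 k hk, add_zero]⟩
      zero_mem' := ⟨L.zero_mem, fun _ _ => rfl⟩
      smul_mem' := fun c x hx => ⟨L.smul_mem c hx.1, fun k hk => by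
        rw [Pi.smul_apply, hx.2 k hk, smul_zero]⟩ }
  -- The `j`-th entries of the vectors in `P` form a principal ideal; it contains `f ≠ 0`, so its
  -- generator is nonzero and can be made monic.
  let I : Ideal F[X] := P.map (LinearMap.proj j)
  obtain ⟨g, hg⟩ := (IsPrincipalIdealRing.principal I).principal
  have hfI : f ∈ I := by
    refine ⟨f • Pi.single j 1, ⟨hL _, fun k hk => ?_⟩, by simp⟩
    simp [hk.ne]
  have hg0 : g ≠ 0 := by
    rintro rfl
    rw [hg] at hfI
    simp at hfI
    exact hf hfI
  have hgI : normalize g ∈ I := by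
    rw [hg]
    exact Ideal.mem_span_singleton.2 (dvd_normalize_iff.2 dvd_rfl)
  obtain ⟨v, hv, hvg⟩ := hgI
  have hvg : v j = normalize g := hvg
  refine ⟨v, hv.1, hv.2, hvg ▸ monic_normalize hg0, fun w hw h0 => ?_⟩
  have hwI : w j ∈ I := ⟨w, ⟨hw, h0⟩, rfl⟩
  rw [hg] at hwI
  rw [hvg]
  exact normalize_dvd_iff.2 (Ideal.mem_span_singleton.1 hwI)

theorem colModule_le {k : ℕ} {Q : Matrix (Fin m) (Fin k) F[X]}
    {L : Submodule F[X] (Fin m → F[X])} (h : ∀ j, (fun i => Q i j) ∈ L) : colModule Q ≤ L := by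
  rintro _ ⟨u, rfl⟩
  have : Q.mulVecLin u = ∑ j, u j • fun i => Q i j := by
    ext i : 1
    simp only [Matrix.mulVecLin_apply, Matrix.mulVec, dotProduct, Finset.sum_apply,
      Pi.smul_apply, smul_eq_mul, mul_comm]
  rw [this]
  exact L.sum_mem fun j _ => L.smul_mem (u j) (h j)

/-- Subtracting multiples of the pivot vectors `c a`, `j < a`, from `c j` makes the entries of
`c j` after the `j`-th one small. -/
theorem exists_reduced_pivot {L : Submodule F[X] (Fin m → F[X])} {c : Fin m → Fin m → F[X]}
    (hcL : ∀ j, c j ∈ L) (hc0 : ∀ j, ∀ k < j, c j k = 0) (hcm : ∀ j, (c j j).Monic)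
    (j : Fin m) (s : ℕ) :
    ∃ v ∈ L, (∀ k ≤ j, v k = c j k) ∧
      ∀ i, j < i → (i : ℕ) < s → (v i).degree < (c i i).degree := by
  induction s with
  | zero => exact ⟨c j, hcL j, fun _ _ => rfl, fun i _ hi => absurd hi (Nat.not_lt_zero _)⟩
  | succ s ih =>
    obtain ⟨v, hv, hvc, hvd⟩ := ih
    by_cases hs : (j : ℕ) < s ∧ s < m
    · obtain ⟨hjs, hsm⟩ := hs
      obtain ⟨a, ha⟩ : ∃ a : Fin m, (a : ℕ) = s := ⟨⟨s, hsm⟩, rfl⟩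
      have hja : j < a := by rw [Fin.lt_def, ha]; exact hjs
      have hsub : ∀ k, (v - (v a /ₘ c a a) • c a) k = v k - (v a /ₘ c a a) * c a k :=
        fun k => rfl
      -- Division with remainder by the pivot `c a a`; entries before `a` stay unchanged because `c
      -- a` vanishes there.
      refine ⟨v - (v a /ₘ c a a) • c a, L.sub_mem hv (L.smul_mem _ (hcL a)), ?_, ?_⟩
      · intro k hk
        rw [hsub, hc0 a k (hk.trans_lt hja), hvc k hk, mul_zero, sub_zero]
      · intro i hji hi
        rw [hsub]
        rcases Nat.lt_succ_iff_lt_or_eq.1 hi with hi | hi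
        · have hia : i < a := by rw [Fin.lt_def, ha]; exact hi
          rw [hc0 a i hia, mul_zero, sub_zero]
          exact hvd i hji hi
        · obtain rfl : i = a := Fin.ext (hi.trans ha.symm)
          rw [mul_comm, ← modByMonic_eq_sub_mul_div]
          exact degree_modByMonic_lt _ (hcm i)
    · refine ⟨v, hv, hvc, fun i hji hi => hvd i hji ?_⟩
      have : (j : ℕ) < i := hji
      have := i.2
      omega

/-- A submodule is spanned by pivot vectors. -/
theorem colModule_eq_of_pivots {L : Submodule F[X] (Fin m → F[X])}
    {Q : Matrix (Fin m) (Fin m) F[X]} (hQL : ∀ j, (fun i => Q i j) ∈ L)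
    (h0 : ∀ i j, i < j → Q i j = 0)
    (hd : ∀ j, ∀ w ∈ L, (∀ k < j, w k = 0) → Q j j ∣ w j) : colModule Q = L := by
  refine le_antisymm (colModule_le hQL) fun w hw => ?_
  -- Gaussian elimination of `w`: at each stage the first remaining entry is a multiple of its pivot
  -- and is cleared by a multiple of that column.
  have key : ∀ s : ℕ, ∃ u ∈ colModule Q, ∀ k : Fin m, (k : ℕ) < s → (w - u) k = 0 := by
    intro s
    induction s with
    | zero => exact ⟨0, Submodule.zero_mem _, fun _ h => absurd h (Nat.not_lt_zero _)⟩
    | succ s ih =>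
      obtain ⟨u, hu, hu0⟩ := ih
      by_cases hsm : s < m
      · obtain ⟨a, ha⟩ : ∃ a : Fin m, (a : ℕ) = s := ⟨⟨s, hsm⟩, rfl⟩
        have hlt : ∀ k < a, (k : ℕ) < s := fun k hk => ha ▸ hk
        obtain ⟨r, hr⟩ := hd a (w - u) (L.sub_mem hw (colModule_le hQL hu))
          fun k hk => hu0 k (hlt k hk)
        refine ⟨u + r • fun i => Q i a, Submodule.add_mem _ hu
          (Submodule.smul_mem _ _ (col_mem_colModule Q a)), fun k hk => ?_⟩
        have hsub : (w - (u + r • fun i => Q i a)) k = (w - u) k - r * Q k a := by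
          simp only [Pi.sub_apply, Pi.add_apply, Pi.smul_apply, smul_eq_mul]
          ring
        rw [hsub]
        rcases Nat.lt_succ_iff_lt_or_eq.1 hk with hk | hk
        · rw [hu0 k hk, h0 k a (by rw [Fin.lt_def, ha]; exact hk), mul_zero, sub_zero]
        · obtain rfl : k = a := Fin.ext (hk.trans ha.symm)
          rw [hr, mul_comm, sub_self]
      · exact ⟨u, hu, fun k _ => hu0 k (by have := k.2; omega)⟩
  obtain ⟨u, hu, hu0⟩ := key m
  have : w = u := funext fun k => sub_eq_zero.1 (hu0 k k.2)
  rwa [this]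

/-- The inclusion `f • F[X]^m ⊆ L` with `f ≠ 0` guarantees a pivot in every position. Reduced pivot
vectors, taken as columns, form the Hermite basis. -/
theorem exists_isHermiteForm_colModule_eq {L : Submodule F[X] (Fin m → F[X])} {f : F[X]}
    (hf : f ≠ 0) (hL : ∀ v : Fin m → F[X], f • v ∈ L) :
    ∃ Q : Matrix (Fin m) (Fin m) F[X], IsHermiteForm Q ∧ colModule Q = L := by
  choose c hcL hc0 hcm hcd using exists_pivot hf hL
  choose v hvL hvc hvd using fun j => exists_reduced_pivot hcL hc0 hcm j m
  have hdiag : ∀ i, v i i = c i i := fun i => hvc i i le_rfl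
  refine ⟨Matrix.of fun i j => v j i, ⟨fun i j hij => ?_, fun i => ?_, fun i j hji => ?_⟩,
    colModule_eq_of_pivots hvL (fun i j hij => ?_) fun j w hw h0 => ?_⟩
  · exact (hvc j i hij.le).trans (hc0 j i hij)
  · rw [Matrix.of_apply, hdiag]
    exact hcm i
  · rw [Matrix.of_apply, Matrix.of_apply, hdiag]
    exact hvd j i hji i.2
  · exact (hvc j i hij.le).trans (hc0 j i hij)
  · rw [Matrix.of_apply, hdiag]
    exact hcd j w hw h0

theorem exists_isHermiteForm_of_det_ne_zero {D : Matrix (Fin m) (Fin m) F[X]} (hD : D.det ≠ 0) :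
    ∃ Q : Matrix (Fin m) (Fin m) F[X], IsHermiteForm Q ∧ colModule Q = colModule D :=
  exists_isHermiteForm_colModule_eq hD (det_smul_mem_colModule D)

open Classical in
/-- The Hermite form with the same column module as a nonsingular matrix. -/
noncomputable def hermiteNF (D : Matrix (Fin m) (Fin m) F[X]) : Matrix (Fin m) (Fin m) F[X] :=
  -- The value `0` at singular matrices is only a default; the normal form is used under a nonzero
  -- determinant.
  if hD : D.det ≠ 0 then (exists_isHermiteForm_of_det_ne_zero hD).choose else 0

theorem isHermiteForm_hermiteNF {D : Matrix (Fin m) (Fin m) F[X]} (hD : D.det ≠ 0) :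
    IsHermiteForm (hermiteNF D) := by
  rw [hermiteNF, dif_pos hD]
  exact (exists_isHermiteForm_of_det_ne_zero hD).choose_spec.1

theorem colModule_hermiteNF {D : Matrix (Fin m) (Fin m) F[X]} (hD : D.det ≠ 0) :
    colModule (hermiteNF D) = colModule D := by
  rw [hermiteNF, dif_pos hD]
  exact (exists_isHermiteForm_of_det_ne_zero hD).choose_spec.2

theorem exists_isHermiteForm_sup {D : Matrix (Fin m) (Fin m) F[X]} (hD : D.det ≠ 0)
    (E : Matrix (Fin m) (Fin m) F[X]) :
    ∃ Q : Matrix (Fin m) (Fin m) F[X], IsHermiteForm Q ∧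
      colModule Q = colModule D ⊔ colModule E :=
  exists_isHermiteForm_colModule_eq hD fun v =>
    Submodule.mem_sup_left (det_smul_mem_colModule D v)

/-- Common left divisors are the matrices whose column module contains the sum. As `D` is
nonsingular, the sum is itself a column module, of some square `Q`; a greatest common left divisor
factors through `Q`, so its right inverse forces the sum to be everything. -/
theorem leftCoprime_iff_sup_eq_top {D E : Matrix (Fin m) (Fin m) F[X]} (hD : D.det ≠ 0) :
    LeftCoprime (c := fun _ : Fin 2 => m) ![D, E] ↔ colModule D ⊔ colModule E = ⊤ := by
  have hdiv : ∀ (l : ℕ) (G : Matrix (Fin m) (Fin l) F[X]),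
      IsCommonLeftDivisor (c := fun _ : Fin 2 => m) ![D, E] G ↔
        colModule D ⊔ colModule E ≤ colModule G := by
    intro l G
    rw [sup_le_iff, colModule_le_iff, colModule_le_iff]
    exact Fin.forall_fin_two
  constructor
  · rintro ⟨k, H, ⟨-, hmax⟩, Y, hY⟩
    obtain ⟨Q, -, hQ⟩ := exists_isHermiteForm_sup hD E
    obtain ⟨S, hS⟩ := hmax m Q ((hdiv m Q).2 hQ.ge)
    rw [← hQ, ← top_le_iff, ← colModule_one, ← hY, hS, Matrix.mul_assoc]
    exact colModule_mul_le _ _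
  · intro h
    refine ⟨m, 1, ⟨(hdiv m 1).2 (by rw [colModule_one]; exact le_top), fun l G hG => ?_⟩, 1,
      Matrix.one_mul 1⟩
    apply colModule_le_iff.1
    rw [colModule_one, ← h]
    exact (hdiv l G).1 hG

theorem IsHermiteForm.colModule_eq_top_iff {Q : Matrix (Fin m) (Fin m) F[X]}
    (h : IsHermiteForm Q) : colModule Q = ⊤ ↔ Q.det.natDegree = 0 := by
  constructor
  · intro ht
    rw [natDegree_det_eq_of_colModule_eq (ht.trans colModule_one.symm), Matrix.det_one,
      natDegree_one]
  · intro h0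
    rw [eq_top_iff]
    intro v _
    have := det_smul_mem_colModule Q v
    rwa [eq_one_of_monic_natDegree_zero h.det_monic h0, one_smul] at this

end Algebra

/-! ### Counting Hermite forms. -/

theorem ncard_entries_mem {α : Type*} {m : ℕ} (S : Fin m → Fin m → Set α) :
    {Q : Matrix (Fin m) (Fin m) α | ∀ i j, Q i j ∈ S i j}.ncard = ∏ i, ∏ j, (S i j).ncard := by
  let e : {Q : Matrix (Fin m) (Fin m) α | ∀ i j, Q i j ∈ S i j} ≃ ∀ i, ∀ j, S i j :=
    { toFun := fun Q i j => ⟨Q.1 i j, Q.2 i j⟩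
      invFun := fun f => ⟨fun i j => (f i j).1, fun i j => (f i j).2⟩
      left_inv := fun _ => rfl
      right_inv := fun _ => rfl }
  rw [← Nat.card_coe_set_eq, Nat.card_congr e, Nat.card_pi]
  refine Finset.prod_congr rfl fun i _ => ?_
  rw [Nat.card_pi]
  exact Finset.prod_congr rfl fun j _ => Nat.card_coe_set_eq _

/-- The matrices of size `m` in Hermite form whose determinant has degree `n`. -/
def hermiteSet (F : Type*) [Field F] (m n : ℕ) : Set (Matrix (Fin m) (Fin m) F[X]) :=
  {Q | IsHermiteForm Q ∧ Q.det.natDegree = n}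

section Count

variable (F : Type*) [Field F] [Fintype F] (m : ℕ)

theorem ncard_degree_lt (k : ℕ) :
    {p : F[X] | p.degree < (k : WithBot ℕ)}.ncard = Fintype.card F ^ k := by
  have h : {p : F[X] | p.degree < (k : WithBot ℕ)} = (degreeLT F k : Set F[X]) := by
    ext p
    exact mem_degreeLT.symm
  rw [h, ← Nat.card_coe_set_eq]
  refine (Nat.card_congr (degreeLTEquiv F k).toEquiv).trans ?_
  rw [Nat.card_pi, Finset.prod_const, Finset.card_univ, Fintype.card_fin, Nat.card_eq_fintype_card]

theorem ncard_monic_natDegree_eq (k : ℕ) :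
    {p : F[X] | p.Monic ∧ p.natDegree = k}.ncard = Fintype.card F ^ k := by
  have h := Nat.card_congr (monicEquivDegreeLT (R := F) k)
  rw [← Nat.card_coe_set_eq]
  refine h.trans ?_
  refine (Nat.card_congr (degreeLTEquiv F k).toEquiv).trans ?_
  rw [Nat.card_pi, Finset.prod_const, Finset.card_univ, Fintype.card_fin, Nat.card_eq_fintype_card]

theorem hermiteSet_finite (n : ℕ) : (hermiteSet F m n).Finite := by
  refine ((hermiteTuples_finite F m (N := 1) fun _ => n).image fun D => D 0).subset ?_
  intro Q hQ
  exact ⟨fun _ => Q, fun _ => hQ, rfl⟩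

/-- Number of Hermite forms whose diagonal entries have prescribed degrees. -/
theorem ncard_hermite_diag_natDegree (κ : Fin m → ℕ) :
    {Q : Matrix (Fin m) (Fin m) F[X] | IsHermiteForm Q ∧ ∀ i, (Q i i).natDegree = κ i}.ncard =
      Fintype.card F ^ ∑ i : Fin m, κ i * (i + 1) := by
  let S : Fin m → Fin m → Set F[X] := fun i j =>
    if i < j then {0} else if i = j then {p | p.Monic ∧ p.natDegree = κ i} else
      {p | p.degree < (κ i : WithBot ℕ)}
  have hS : {Q : Matrix (Fin m) (Fin m) F[X] | IsHermiteForm Q ∧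
      ∀ i, (Q i i).natDegree = κ i} = {Q | ∀ i j, Q i j ∈ S i j} := by
    ext Q
    constructor
    · rintro ⟨h, hκ⟩ i j
      rcases lt_trichotomy i j with hij | rfl | hij
      · simpa [S, hij] using h.upper_eq_zero i j hij
      · simpa [S] using ⟨h.monic_diag i, hκ i⟩
      · have := h.degree_lt i j hij
        rw [degree_eq_natDegree (h.monic_diag i).ne_zero, hκ i] at this
        simpa [S, hij.not_gt, hij.ne'] using this
    · intro h
      have hd : ∀ i, (Q i i).Monic ∧ (Q i i).natDegree = κ i := fun i => by
        simpa [S] using h i i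
      refine ⟨⟨fun i j hij => ?_, fun i => (hd i).1, fun i j hij => ?_⟩, fun i => (hd i).2⟩
      · simpa [S, hij] using h i j
      · rw [degree_eq_natDegree (hd i).1.ne_zero, (hd i).2]
        simpa [S, hij.not_gt, hij.ne'] using h i j
  -- A monic polynomial of degree `κ i` and a polynomial of degree below `κ i` both have `q ^ κ i`
  -- choices, so all `i + 1` entries of row `i` up to the diagonal count alike.
  have hc : ∀ i j, (S i j).ncard = if j ≤ i then Fintype.card F ^ κ i else 1 := by
    intro i j
    rcases lt_trichotomy i j with hij | rfl | hij
    · simp [S, hij]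
    · simp [S, ncard_monic_natDegree_eq]
    · simp [S, hij.not_gt, hij.ne', hij.le, ncard_degree_lt]
  rw [hS, ncard_entries_mem, ← Finset.prod_pow_eq_pow_sum]
  refine Finset.prod_congr rfl fun i _ => ?_
  simp_rw [hc]
  rw [Finset.prod_ite, Finset.prod_const, Finset.prod_const_one, mul_one, pow_mul]
  congr 1
  rw [← Fin.card_Iic]
  congr 1
  ext j
  simp

/-- Number of Hermite forms with prescribed diagonal entries. -/
theorem ncard_hermite_diag (g : Fin m → F[X]) (hg : ∀ i, (g i).Monic) :
    {Q : Matrix (Fin m) (Fin m) F[X] | IsHermiteForm Q ∧ ∀ i, Q i i = g i}.ncard =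
      Fintype.card F ^ ∑ i : Fin m, (g i).natDegree * i := by
  let S : Fin m → Fin m → Set F[X] := fun i j =>
    if i < j then {0} else if i = j then {g i} else {p | p.degree < (g i).natDegree}
  have hS : {Q : Matrix (Fin m) (Fin m) F[X] | IsHermiteForm Q ∧
      ∀ i, Q i i = g i} = {Q | ∀ i j, Q i j ∈ S i j} := by
    ext Q
    constructor
    · rintro ⟨h, hκ⟩ i j
      rcases lt_trichotomy i j with hij | rfl | hij
      · simpa [S, hij] using h.upper_eq_zero i j hij
      · simpa [S] using hκ i
      · have := h.degree_lt i j hij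
        rw [hκ i, degree_eq_natDegree (hg i).ne_zero] at this
        simpa [S, hij.not_gt, hij.ne'] using this
    · intro h
      have hd : ∀ i, Q i i = g i := fun i => by simpa [S] using h i i
      refine ⟨⟨fun i j hij => ?_, fun i => (hd i).symm ▸ hg i, fun i j hij => ?_⟩, hd⟩
      · simpa [S, hij] using h i j
      · rw [hd i, degree_eq_natDegree (hg i).ne_zero]
        simpa [S, hij.not_gt, hij.ne'] using h i j
  have hc : ∀ i j, (S i j).ncard = if j < i then Fintype.card F ^ (g i).natDegree else 1 := by
    intro i j
    rcases lt_trichotomy i j with hij | rfl | hij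
    · simp [S, hij, hij.not_gt]
    · simp [S]
    · simp [S, hij.not_gt, hij.ne', hij, ncard_degree_lt]
  rw [hS, ncard_entries_mem, ← Finset.prod_pow_eq_pow_sum]
  refine Finset.prod_congr rfl fun i _ => ?_
  simp_rw [hc]
  rw [Finset.prod_ite, Finset.prod_const, Finset.prod_const_one, mul_one, pow_mul]
  congr 1
  rw [← Fin.card_Iio]
  congr 1
  ext j
  simp

variable {m}

theorem pow_le_ncard_hermiteSet (hm : 1 ≤ m) (n : ℕ) :
    Fintype.card F ^ (m * n) ≤ (hermiteSet F m n).ncard := by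
  let a : Fin m := ⟨m - 1, by omega⟩
  have h := ncard_hermite_diag_natDegree F m (Pi.single a n)
  have he : ∑ i : Fin m, (Pi.single a n : Fin m → ℕ) i * (i + 1) = m * n := by
    rw [Finset.sum_eq_single a (fun b _ hb => by simp [hb]) (by simp)]
    have : (a : ℕ) + 1 = m := Nat.sub_add_cancel hm
    rw [Pi.single_eq_same, this, mul_comm]
  rw [he] at h
  rw [← h]
  refine Set.ncard_le_ncard ?_ (hermiteSet_finite F m n)
  rintro Q ⟨hQ, hκ⟩
  refine ⟨hQ, ?_⟩
  rw [hQ.det_natDegree, Finset.sum_congr rfl fun i _ => hκ i, Finset.sum_pi_single']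
  simp

/-- Moving any degree away from the last diagonal entry lowers the exponent `∑ κ i * (i + 1)` below
`m * n` and so costs at least a factor `q`; there are at most `(n + 1) ^ m` degree vectors. -/
theorem ncard_hermiteSet_le (hm : 1 ≤ m) (n : ℕ) :
    ((hermiteSet F m n).ncard : ℝ) ≤
      (Fintype.card F : ℝ) ^ (m * n) * (1 + ((n : ℝ) + 1) ^ m / Fintype.card F) := by
  classical
  let B : (Fin m → ℕ) → Set (Matrix (Fin m) (Fin m) F[X]) := fun κ =>
    {Q | IsHermiteForm Q ∧ ∀ i, (Q i i).natDegree = κ i}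
  have hB : ∀ κ, (B κ).ncard = Fintype.card F ^ ∑ i : Fin m, κ i * (i + 1) :=
    ncard_hermite_diag_natDegree F m
  have hfin : ∀ κ, (B κ).Finite := fun κ => by
    refine Set.finite_of_ncard_pos ?_
    rw [hB]
    exact pow_pos Fintype.card_pos _
  let a : Fin m := ⟨m - 1, by omega⟩
  have ha : (a : ℕ) + 1 = m := Nat.sub_add_cancel hm
  let T : Finset (Fin m → ℕ) :=
    (Fintype.piFinset fun _ : Fin m => Finset.range (n + 1)).filter fun κ =>
      ∑ i : Fin m, κ i * (i + 1) < m * n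
  have hsub : hermiteSet F m n ⊆ B (Pi.single a n) ∪ ⋃ κ ∈ T, B κ := by
    rintro Q ⟨hQ, hd⟩
    rw [hQ.det_natDegree] at hd
    by_cases hz : ∀ i, i ≠ a → (Q i i).natDegree = 0
    · left
      refine ⟨hQ, fun i => ?_⟩
      rw [Finset.sum_eq_single a (fun b _ hb => hz b hb) (by simp)] at hd
      by_cases hi : i = a
      · subst hi
        rw [hd, Pi.single_eq_same]
      · rw [hz i hi, Pi.single_eq_of_ne hi]
    · right
      push Not at hz
      obtain ⟨b, hba, hb⟩ := hz
      refine Set.mem_biUnion (x := fun i => (Q i i).natDegree) ?_ ⟨hQ, fun _ => rfl⟩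
      refine Finset.mem_filter.2 ⟨Fintype.mem_piFinset.2 fun i => ?_, ?_⟩
      · rw [Finset.mem_range, Nat.lt_succ_iff, ← hd]
        exact Finset.single_le_sum (f := fun i => (Q i i).natDegree)
          (fun _ _ => Nat.zero_le _) (Finset.mem_univ i)
      · rw [← hd, mul_comm, Finset.sum_mul]
        -- Every weight `i + 1` is at most `m`, strictly so at `b`, which is not the last index and
        -- has positive degree.
        refine Finset.sum_lt_sum (fun i _ => Nat.mul_le_mul_left _ i.2) ⟨b, Finset.mem_univ b, ?_⟩
        refine Nat.mul_lt_mul_of_pos_left ?_ (Nat.pos_of_ne_zero hb)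
        have h1 : (b : ℕ) ≠ a := fun h => hba (Fin.ext h)
        have h2 := b.2
        omega
  have hunion : (⋃ κ ∈ T, B κ).Finite := T.finite_toSet.biUnion fun κ _ => hfin κ
  have hq : (0 : ℝ) < Fintype.card F := by exact_mod_cast Fintype.card_pos
  have hq1 : (1 : ℝ) ≤ Fintype.card F := by exact_mod_cast Fintype.card_pos
  have hle : (hermiteSet F m n).ncard ≤ Fintype.card F ^ (m * n) + ∑ κ ∈ T, (B κ).ncard := by
    refine (Set.ncard_le_ncard hsub ((hfin _).union hunion)).trans
      ((Set.ncard_union_le _ _).trans (Nat.add_le_add (le_of_eq ?_)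
        (T.set_ncard_biUnion_le B)))
    rw [hB, Finset.sum_eq_single a (fun b _ hb => by simp [hb]) (by simp), Pi.single_eq_same, ha,
      mul_comm]
  have hT : (T.card : ℝ) ≤ ((n : ℝ) + 1) ^ m := by
    have : T.card ≤ (n + 1) ^ m := (Finset.card_filter_le _ _).trans (by simp)
    exact_mod_cast this
  calc ((hermiteSet F m n).ncard : ℝ)
      ≤ (Fintype.card F : ℝ) ^ (m * n) + ∑ κ ∈ T, ((B κ).ncard : ℝ) := by exact_mod_cast hle
    _ ≤ (Fintype.card F : ℝ) ^ (m * n) +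
        ∑ κ ∈ T, (Fintype.card F : ℝ) ^ (m * n) / Fintype.card F := by
        gcongr with κ hκ
        have hlt := (Finset.mem_filter.1 hκ).2
        rw [hB, le_div_iff₀ hq, Nat.cast_pow, ← pow_succ]
        exact pow_le_pow_right₀ hq1 hlt
    _ = (Fintype.card F : ℝ) ^ (m * n) * (1 + T.card / Fintype.card F) := by
        rw [Finset.sum_const, nsmul_eq_mul]
        ring
    _ ≤ _ := by gcongr

end Count

/-! ### Number of monic divisors of a polynomial. -/

section Divisors

open UniqueFactorizationMonoid in
/-- A polynomial of degree `n` has at most `2 ^ n` monic divisors. -/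
theorem exists_finset_monic_dvd {F : Type*} [Field F] {f : F[X]} (hf : f ≠ 0) :
    ∃ T : Finset F[X], T.card ≤ 2 ^ f.natDegree ∧ ∀ g : F[X], g.Monic → g ∣ f → g ∈ T := by
  classical
  -- Monic divisors are products of submultisets of the irreducible factors, of which there are at
  -- most `f.natDegree`, each having positive degree.
  refine ⟨((normalizedFactors f).powerset.map Multiset.prod).toFinset, ?_, fun g hg hgf => ?_⟩
  · refine (Multiset.toFinset_card_le _).trans ?_
    rw [Multiset.card_map, Multiset.card_powerset]
    refine Nat.pow_le_pow_right two_pos ?_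
    have hprod : (normalizedFactors f).prod.natDegree = f.natDegree :=
      natDegree_eq_of_degree_eq
        (degree_eq_degree_of_associated (prod_normalizedFactors hf))
    have hmon : ∀ p ∈ normalizedFactors f, p ≠ 0 := fun p hp =>
      (irreducible_of_normalized_factor p hp).ne_zero
    rw [← hprod, natDegree_multiset_prod _ fun h0 => hmon 0 h0 rfl]
    have : (normalizedFactors f).card • 1 ≤ ((normalizedFactors f).map natDegree).sum := by
      rw [← Multiset.card_map natDegree]
      refine Multiset.card_nsmul_le_sum fun d hd => ?_
      obtain ⟨p, hp, rfl⟩ := Multiset.mem_map.1 hd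
      exact (irreducible_of_normalized_factor p hp).natDegree_pos
    simpa using this
  · rw [Multiset.mem_toFinset, Multiset.mem_map]
    refine ⟨normalizedFactors g, Multiset.mem_powerset.2
      ((dvd_iff_normalizedFactors_le_normalizedFactors hg.ne_zero hf).1 hgf), ?_⟩
    rw [prod_normalizedFactors_eq hg.ne_zero, hg.normalize_eq_self]

end Divisors

/-! ### Pairs of Hermite forms and their common left divisors. -/

section Pairs

variable {F : Type*} [Field F] {m : ℕ}

theorem natDegree_hermiteNF_mul {G Q : Matrix (Fin m) (Fin m) F[X]} (hG : G.det ≠ 0)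
    (hQ : Q.det ≠ 0) :
    (hermiteNF (G * Q)).det.natDegree = G.det.natDegree + Q.det.natDegree := by
  have h : (G * Q).det ≠ 0 := by
    rw [Matrix.det_mul]
    exact mul_ne_zero hG hQ
  rw [natDegree_det_eq_of_colModule_eq (colModule_hermiteNF h), Matrix.det_mul,
    natDegree_mul hG hQ]

theorem colModule_hermiteNF_mul {G Q : Matrix (Fin m) (Fin m) F[X]} (hG : G.det ≠ 0)
    (hQ : Q.det ≠ 0) : colModule (hermiteNF (G * Q)) = (colModule Q).map G.mulVecLin := by
  rw [colModule_hermiteNF (by rw [Matrix.det_mul]; exact mul_ne_zero hG hQ), colModule_mul]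

/-- The column module of `hermiteNF (G * Q)` is the image of that of `Q` under the injective map
`G`, so it determines the column module of `Q`, hence `Q`. -/
theorem hermiteNF_mul_injective {G Q Q' : Matrix (Fin m) (Fin m) F[X]} (hG : G.det ≠ 0)
    (hQ : IsHermiteForm Q) (hQ' : IsHermiteForm Q')
    (h : hermiteNF (G * Q) = hermiteNF (G * Q')) : Q = Q' := by
  refine hQ.eq_of_colModule_eq hQ' ?_
  refine Submodule.map_injective_of_injective (mulVecLin_injective_of_det_ne_zero hG) ?_
  rw [← colModule_hermiteNF_mul hG hQ.det_ne_zero, ← colModule_hermiteNF_mul hG hQ'.det_ne_zero, h]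

/-- A Hermite form that is left divisible by `G` comes from a unique Hermite form by
left multiplication with `G`. -/
theorem IsHermiteForm.exists_eq_hermiteNF_mul {G D : Matrix (Fin m) (Fin m) F[X]}
    (hD : IsHermiteForm D) (h : colModule D ≤ colModule G) :
    ∃ Q : Matrix (Fin m) (Fin m) F[X], IsHermiteForm Q ∧ D = hermiteNF (G * Q) ∧
      D.det.natDegree = G.det.natDegree + Q.det.natDegree := by
  obtain ⟨Y, rfl⟩ := colModule_le_iff.1 h
  have h0 := hD.det_ne_zero
  rw [Matrix.det_mul] at h0
  have hY := right_ne_zero_of_mul h0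
  have hG := left_ne_zero_of_mul h0
  have hQ := isHermiteForm_hermiteNF hY
  have hGQ : (G * hermiteNF Y).det ≠ 0 := by
    rw [Matrix.det_mul]
    exact mul_ne_zero hG hQ.det_ne_zero
  have heq : G * Y = hermiteNF (G * hermiteNF Y) := by
    refine hD.eq_of_colModule_eq (isHermiteForm_hermiteNF hGQ) ?_
    rw [colModule_hermiteNF_mul hG hQ.det_ne_zero, colModule_hermiteNF hY, colModule_mul]
  refine ⟨hermiteNF Y, hQ, heq, ?_⟩
  rw [natDegree_det_eq_of_colModule_eq (colModule_hermiteNF hY), Matrix.det_mul,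
    natDegree_mul hG hY]

variable (F m) in
/-- The pairs of Hermite forms with determinants of degrees `a` and `b` whose column modules
span everything. -/
def coprimePairs (a b : ℕ) : Set (Matrix (Fin m) (Fin m) F[X] × Matrix (Fin m) (Fin m) F[X]) :=
  {p | p.1 ∈ hermiteSet F m a ∧ p.2 ∈ hermiteSet F m b ∧ colModule p.1 ⊔ colModule p.2 = ⊤}

variable (F m) in
/-- The pairs of Hermite forms with determinants of degrees `a` and `b` whose column modules
do not span everything. -/
def nonCoprimePairs (a b : ℕ) :
    Set (Matrix (Fin m) (Fin m) F[X] × Matrix (Fin m) (Fin m) F[X]) :=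
  {p | p.1 ∈ hermiteSet F m a ∧ p.2 ∈ hermiteSet F m b ∧ colModule p.1 ⊔ colModule p.2 ≠ ⊤}

/-- Number of Hermite forms that are left divisible by `G`. -/
theorem ncard_hermiteSet_colModule_le {G : Matrix (Fin m) (Fin m) F[X]} (hG : G.det ≠ 0)
    {n : ℕ} (hn : G.det.natDegree ≤ n) :
    {D | D ∈ hermiteSet F m n ∧ colModule D ≤ colModule G}.ncard =
      (hermiteSet F m (n - G.det.natDegree)).ncard := by
  symm
  refine Set.ncard_congr (fun Q _ => hermiteNF (G * Q)) ?_ ?_ ?_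
  · rintro Q ⟨hQ, hd⟩
    refine ⟨⟨isHermiteForm_hermiteNF ?_, ?_⟩, ?_⟩
    · rw [Matrix.det_mul]
      exact mul_ne_zero hG hQ.det_ne_zero
    · rw [natDegree_hermiteNF_mul hG hQ.det_ne_zero, hd]
      omega
    · rw [colModule_hermiteNF_mul hG hQ.det_ne_zero]
      exact LinearMap.map_le_range
  · exact fun Q Q' hQ hQ' h => hermiteNF_mul_injective hG hQ.1 hQ'.1 h
  · rintro D ⟨⟨hD, hd⟩, hle⟩
    obtain ⟨Q, hQ, h1, h2⟩ := hD.exists_eq_hermiteNF_mul hle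
    exact ⟨Q, ⟨hQ, by omega⟩, h1.symm⟩

theorem natDegree_det_le_of_colModule_le {G D : Matrix (Fin m) (Fin m) F[X]} (hD : D.det ≠ 0)
    (h : colModule D ≤ colModule G) : G.det.natDegree ≤ D.det.natDegree := by
  obtain ⟨Y, rfl⟩ := colModule_le_iff.1 h
  refine natDegree_le_of_dvd ?_ hD
  rw [Matrix.det_mul]
  exact dvd_mul_right _ _

variable [Fintype F]

theorem nonCoprimePairs_finite (a b : ℕ) : (nonCoprimePairs F m a b).Finite :=
  ((hermiteSet_finite F m a).prod (hermiteSet_finite F m b)).subset fun _ hp => ⟨hp.1, hp.2.1⟩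

theorem coprimePairs_finite (a b : ℕ) : (coprimePairs F m a b).Finite :=
  ((hermiteSet_finite F m a).prod (hermiteSet_finite F m b)).subset fun _ hp => ⟨hp.1, hp.2.1⟩

theorem ncard_coprimePairs_add (a b : ℕ) :
    (coprimePairs F m a b).ncard + (nonCoprimePairs F m a b).ncard =
      (hermiteSet F m a).ncard * (hermiteSet F m b).ncard := by
  rw [← Set.ncard_prod, ← Set.ncard_union_eq ?_ (coprimePairs_finite a b)
    (nonCoprimePairs_finite a b)]
  · congr 1
    ext p
    simp only [coprimePairs, nonCoprimePairs, Set.mem_union, Set.mem_ofPred_eq, Set.mem_prod]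
    tauto
  · exact Set.disjoint_left.2 fun p hp hp' => hp'.2.2 hp.2.2

/-- Sorted by the Hermite basis of the sum of the column modules, of degree `d`: both members are
left divisible by it. This is only a union bound, as the cofactors are not required to be coprime.
-/
theorem ncard_nonCoprimePairs_le (a b : ℕ) :
    (nonCoprimePairs F m a b).ncard ≤ ∑ d ∈ Finset.Icc 1 (min a b), (hermiteSet F m d).ncard *
      ((hermiteSet F m (a - d)).ncard * (hermiteSet F m (b - d)).ncard) := by
  classical
  let H : ℕ → Finset (Matrix (Fin m) (Fin m) F[X]) := fun d => (hermiteSet_finite F m d).toFinset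
  have hH : ∀ d G, G ∈ H d ↔ G ∈ hermiteSet F m d := fun d G => Set.Finite.mem_toFinset _
  have hHc : ∀ d, (H d).card = (hermiteSet F m d).ncard := fun d =>
    (Set.ncard_eq_toFinset_card _ _).symm
  let U : ℕ → Matrix (Fin m) (Fin m) F[X] → Set (Matrix (Fin m) (Fin m) F[X]) := fun n G =>
    {D | D ∈ hermiteSet F m n ∧ colModule D ≤ colModule G}
  have hUfin : ∀ n G, (U n G).Finite := fun n G => (hermiteSet_finite F m n).subset fun _ h => h.1
  have hsub : nonCoprimePairs F m a b ⊆
      ⋃ d ∈ Finset.Icc 1 (min a b), ⋃ G ∈ H d, U a G ×ˢ U b G := by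
    rintro ⟨D, E⟩ ⟨hD, hE, hne⟩
    obtain ⟨Q, hQ, hsup⟩ := exists_isHermiteForm_sup hD.1.det_ne_zero E
    have hDQ : colModule D ≤ colModule Q := hsup ▸ le_sup_left
    have hEQ : colModule E ≤ colModule Q := hsup ▸ le_sup_right
    have h1 := natDegree_det_le_of_colModule_le hD.1.det_ne_zero hDQ
    have h2 := natDegree_det_le_of_colModule_le hE.1.det_ne_zero hEQ
    rw [hD.2] at h1
    rw [hE.2] at h2
    have h0 : Q.det.natDegree ≠ 0 := fun h0 => hne (hsup ▸ hQ.colModule_eq_top_iff.2 h0)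
    refine Set.mem_biUnion (x := Q.det.natDegree)
      (Finset.mem_coe.2 (Finset.mem_Icc.2 ⟨by omega, by omega⟩))
      (Set.mem_biUnion (x := Q) ((hH _ _).2 ⟨hQ, rfl⟩) ⟨⟨hD, hDQ⟩, ⟨hE, hEQ⟩⟩)
  refine (Set.ncard_le_ncard hsub ?_).trans ?_
  · exact (Finset.finite_toSet _).biUnion fun d _ => (Finset.finite_toSet _).biUnion fun G _ =>
      (hUfin a G).prod (hUfin b G)
  refine (Finset.set_ncard_biUnion_le _ _).trans (Finset.sum_le_sum fun d hd => ?_)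
  refine (Finset.set_ncard_biUnion_le _ _).trans ?_
  rw [← hHc, ← smul_eq_mul]
  refine Finset.sum_le_card_nsmul _ _ _ fun G hG => le_of_eq ?_
  obtain ⟨hG1, rfl⟩ := (hH _ _).1 hG
  have hd' := (Finset.mem_Icc.1 hd).2
  rw [Set.ncard_prod, ncard_hermiteSet_colModule_le hG1.det_ne_zero (by omega),
    ncard_hermiteSet_colModule_le hG1.det_ne_zero (by omega)]

/-- For a coprime pair `(Q, R)` the column modules of `G * Q` and `G * R` add up to that of `G`. So
the products determine `G`, then `Q` and `R`, and they are not coprime because `d ≥ 1`. -/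
theorem le_ncard_nonCoprimePairs {a b d : ℕ} (hd : 1 ≤ d) (ha : d ≤ a) (hb : d ≤ b) :
    (hermiteSet F m d).ncard * (coprimePairs F m (a - d) (b - d)).ncard ≤
      (nonCoprimePairs F m a b).ncard := by
  rw [← Set.ncard_prod]
  have hdet : ∀ {G Q : Matrix (Fin m) (Fin m) F[X]}, G.det ≠ 0 → Q.det ≠ 0 → (G * Q).det ≠ 0 :=
    fun h1 h2 => by rw [Matrix.det_mul]; exact mul_ne_zero h1 h2
  have hsup : ∀ G Q R : Matrix (Fin m) (Fin m) F[X], IsHermiteForm G → IsHermiteForm Q →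
      IsHermiteForm R → colModule Q ⊔ colModule R = ⊤ →
      colModule (hermiteNF (G * Q)) ⊔ colModule (hermiteNF (G * R)) = colModule G := by
    intro G Q R hG hQ hR h
    rw [colModule_hermiteNF_mul hG.det_ne_zero hQ.det_ne_zero,
      colModule_hermiteNF_mul hG.det_ne_zero hR.det_ne_zero, ← Submodule.map_sup, h,
      Submodule.map_top]
    rfl
  refine Set.ncard_le_ncard_of_injOn
    (fun x => (hermiteNF (x.1 * x.2.1), hermiteNF (x.1 * x.2.2))) ?_ ?_
    (nonCoprimePairs_finite a b)
  · rintro ⟨G, Q, R⟩ ⟨⟨hG, hGd⟩, ⟨hQ, hQd⟩, ⟨hR, hRd⟩, h⟩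
    refine ⟨⟨isHermiteForm_hermiteNF (hdet hG.det_ne_zero hQ.det_ne_zero), ?_⟩,
      ⟨isHermiteForm_hermiteNF (hdet hG.det_ne_zero hR.det_ne_zero), ?_⟩, ?_⟩
    · refine (natDegree_hermiteNF_mul hG.det_ne_zero hQ.det_ne_zero).trans ?_
      rw [hGd, hQd]
      omega
    · refine (natDegree_hermiteNF_mul hG.det_ne_zero hR.det_ne_zero).trans ?_
      rw [hGd, hRd]
      omega
    · intro htop
      have := (hsup G Q R hG hQ hR h).symm.trans htop
      rw [hG.colModule_eq_top_iff] at this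
      omega
  · rintro ⟨G, Q, R⟩ ⟨⟨hG, hGd⟩, ⟨hQ, hQd⟩, ⟨hR, hRd⟩, h⟩ ⟨G', Q', R'⟩
      ⟨⟨hG', hGd'⟩, ⟨hQ', hQd'⟩, ⟨hR', hRd'⟩, h'⟩ heq
    obtain ⟨h1, h2⟩ := Prod.mk.inj heq
    dsimp only at *
    have hGG : G = G' := by
      refine hG.eq_of_colModule_eq hG' ?_
      rw [← hsup G Q R hG hQ hR h, ← hsup G' Q' R' hG' hQ' hR' h', h1, h2]
    subst hGG
    rw [hermiteNF_mul_injective hG.det_ne_zero hQ hQ' h1,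
      hermiteNF_mul_injective hG.det_ne_zero hR hR' h2]

/-- A nonsingular matrix with determinant of degree `n` has few left divisors in Hermite form. -/
theorem ncard_left_divisors_le {D : Matrix (Fin m) (Fin m) F[X]} (hD : D.det ≠ 0) (d : ℕ) :
    {H | H ∈ hermiteSet F m d ∧ colModule D ≤ colModule H}.ncard ≤
      (2 ^ D.det.natDegree) ^ m * Fintype.card F ^ ((m - 1) * d) := by
  classical
  obtain ⟨T, hTc, hT⟩ := exists_finset_monic_dvd hD
  let P : Finset (Fin m → F[X]) := (Fintype.piFinset fun _ : Fin m => T).filter fun g =>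
    (∀ i, (g i).Monic) ∧ ∑ i, (g i).natDegree = d
  let B : (Fin m → F[X]) → Set (Matrix (Fin m) (Fin m) F[X]) := fun g =>
    {Q | IsHermiteForm Q ∧ ∀ i, Q i i = g i}
  have hBc : ∀ g ∈ P, (B g).ncard = Fintype.card F ^ ∑ i : Fin m, (g i).natDegree * i :=
    fun g hg => ncard_hermite_diag F m g (Finset.mem_filter.1 hg).2.1
  have hBfin : ∀ g ∈ P, (B g).Finite := fun g hg => by
    refine Set.finite_of_ncard_pos ?_
    rw [hBc g hg]
    exact pow_pos Fintype.card_pos _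
  -- Each diagonal entry of a left divisor `H` divides `det H`, which divides `det D`; this leaves
  -- at most `(2 ^ deg det D) ^ m` diagonals.
  have hsub : {H | H ∈ hermiteSet F m d ∧ colModule D ≤ colModule H} ⊆ ⋃ g ∈ P, B g := by
    rintro H ⟨⟨hH, hd⟩, hle⟩
    refine Set.mem_biUnion (x := fun i => H i i) ?_ ⟨hH, fun _ => rfl⟩
    refine Finset.mem_filter.2 ⟨Fintype.mem_piFinset.2 fun i => hT _ (hH.monic_diag i) ?_,
      hH.monic_diag, by rw [← hd, hH.det_natDegree]⟩
    obtain ⟨Y, rfl⟩ := colModule_le_iff.1 hle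
    rw [Matrix.det_mul, Matrix.det_of_isLowerTriangular H
      (fun i j hij => hH.upper_eq_zero i j hij)]
    exact (Finset.dvd_prod_of_mem (fun i => H i i) (Finset.mem_univ i)).trans (dvd_mul_right _ _)
  refine (Set.ncard_le_ncard hsub (P.finite_toSet.biUnion hBfin)).trans ?_
  refine (P.set_ncard_biUnion_le B).trans ?_
  refine (Finset.sum_le_card_nsmul P _ (Fintype.card F ^ ((m - 1) * d)) fun g hg => ?_).trans ?_
  -- With the diagonal fixed, row `i` has only `i ≤ m - 1` free entries. This saves `q ^ d` compared
  -- with the total count.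
  · rw [hBc g hg, ← (Finset.mem_filter.1 hg).2.2, mul_comm, Finset.sum_mul]
    refine Nat.pow_le_pow_right Fintype.card_pos (Finset.sum_le_sum fun i _ => ?_)
    exact Nat.mul_le_mul_left _ (by have := i.2; omega)
  · rw [smul_eq_mul]
    refine Nat.mul_le_mul_right _ ((Finset.card_filter_le _ _).trans ?_)
    rw [Fintype.card_piFinset, Finset.prod_const, Finset.card_univ, Fintype.card_fin]
    exact Nat.pow_le_pow_left hTc m

/-- The Hermite forms that are not left coprime to a given nonsingular matrix. -/
theorem ncard_nonCoprime_le {D : Matrix (Fin m) (Fin m) F[X]} (hD : D.det ≠ 0) (n : ℕ) :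
    {E | E ∈ hermiteSet F m n ∧ colModule D ⊔ colModule E ≠ ⊤}.ncard ≤
      ∑ d ∈ Finset.Icc 1 n, (2 ^ D.det.natDegree) ^ m * Fintype.card F ^ ((m - 1) * d) *
        (hermiteSet F m (n - d)).ncard := by
  classical
  have hfin : ∀ d, {H | H ∈ hermiteSet F m d ∧ colModule D ≤ colModule H}.Finite := fun d =>
    (hermiteSet_finite F m d).subset fun _ h => h.1
  let U : Matrix (Fin m) (Fin m) F[X] → Set (Matrix (Fin m) (Fin m) F[X]) := fun G =>
    {E | E ∈ hermiteSet F m n ∧ colModule E ≤ colModule G}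
  have hUfin : ∀ G, (U G).Finite := fun G => (hermiteSet_finite F m n).subset fun _ h => h.1
  have hsub : {E | E ∈ hermiteSet F m n ∧ colModule D ⊔ colModule E ≠ ⊤} ⊆
      ⋃ d ∈ Finset.Icc 1 n, ⋃ G ∈ (hfin d).toFinset, U G := by
    rintro E ⟨hE, hne⟩
    obtain ⟨Q, hQ, hsup⟩ := exists_isHermiteForm_sup hD E
    have hEQ : colModule E ≤ colModule Q := hsup ▸ le_sup_right
    have h2 := natDegree_det_le_of_colModule_le hE.1.det_ne_zero hEQ
    rw [hE.2] at h2
    have h0 : Q.det.natDegree ≠ 0 := fun h0 => hne (hsup ▸ hQ.colModule_eq_top_iff.2 h0)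
    exact Set.mem_biUnion (x := Q.det.natDegree)
      (Finset.mem_coe.2 (Finset.mem_Icc.2 ⟨by omega, h2⟩))
      (Set.mem_biUnion (x := Q) ((Set.Finite.mem_toFinset _).2
        ⟨⟨hQ, rfl⟩, hsup ▸ le_sup_left⟩) ⟨hE, hEQ⟩)
  refine (Set.ncard_le_ncard hsub ?_).trans ?_
  · exact (Finset.finite_toSet _).biUnion fun d _ => (Finset.finite_toSet _).biUnion fun G _ =>
      hUfin G
  refine (Finset.set_ncard_biUnion_le _ _).trans (Finset.sum_le_sum fun d hd => ?_)
  refine (Finset.set_ncard_biUnion_le _ _).trans ?_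
  refine (Finset.sum_le_card_nsmul _ _ (hermiteSet F m (n - d)).ncard fun G hG => ?_).trans ?_
  · obtain ⟨⟨hG1, rfl⟩, -⟩ := (Set.Finite.mem_toFinset _).1 hG
    exact (ncard_hermiteSet_colModule_le hG1.det_ne_zero (Finset.mem_Icc.1 hd).2).le
  · rw [smul_eq_mul, ← Set.ncard_eq_toFinset_card _ (hfin d)]
    exact Nat.mul_le_mul_right _ (ncard_left_divisors_le hD d)

end Pairs

/-! ### Resampling coordinates of a finite product. -/

section Probability

theorem natCast_ncard_setOf {α : Type*} [Fintype α] (p : α → Prop) [DecidablePred p] :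
    (({x | p x}.ncard : ℕ) : ℝ) = ∑ x, if p x then 1 else 0 := by
  rw [Set.ncard_eq_toFinset_card', Finset.sum_boole, Set.toFinset_ofPred]

theorem natCast_card_filter_fst_lt_snd (N : ℕ) :
    (((Finset.univ.filter fun e : Fin N × Fin N => e.1 < e.2).card : ℕ) : ℝ) =
      (N : ℝ) * ((N : ℝ) - 1) / 2 := by
  have h : (Finset.univ.filter fun e : Fin N × Fin N => e.1 < e.2).card =
      ∑ i ∈ Finset.range N, i := by
    rw [Finset.card_filter, Fintype.sum_prod_type_right, ← Fin.sum_univ_eq_sum_range]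
    refine Finset.sum_congr rfl fun j _ => ?_
    rw [← Finset.card_filter, ← Fin.card_Iio]
    congr 1
    ext i
    simp
  have h2 := Finset.sum_range_id_mul_two N
  rw [← h] at h2
  rw [eq_div_iff two_ne_zero]
  rcases N with _ | N
  · simp at h2 ⊢
  · have h3 : (((Finset.univ.filter fun e : Fin (N + 1) × Fin (N + 1) => e.1 < e.2).card * 2 : ℕ)
        : ℝ) = (((N + 1) * (N + 1 - 1) : ℕ) : ℝ) := congrArg _ h2
    push_cast [Nat.add_sub_cancel] at h3 ⊢
    rw [h3]
    ring

variable {ι : Type*} [Fintype ι] [DecidableEq ι] {S : ι → Type*} [∀ i, Fintype (S i)]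

/-- Resampling one coordinate of a point of a finite product. -/
theorem sum_sum_update (j : ι) (f : (∀ i, S i) → ℝ) :
    ∑ x, ∑ y : S j, f (Function.update x j y) = Fintype.card (S j) * ∑ x, f x := by
  -- Exchanging the `j`-th coordinate with the extra sample is an involution.
  let e : (∀ i, S i) × S j ≃ (∀ i, S i) × S j :=
    { toFun := fun p => (Function.update p.1 j p.2, p.1 j)
      invFun := fun p => (Function.update p.1 j p.2, p.1 j)
      left_inv := fun p => by simp
      right_inv := fun p => by simp }
  have h : ∑ p : (∀ i, S i) × S j, f (Function.update p.1 j p.2) =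
      ∑ p : (∀ i, S i) × S j, f p.1 :=
    Fintype.sum_equiv e _ (fun p => f p.1) fun _ => rfl
  rw [Fintype.sum_prod_type, Fintype.sum_prod_type] at h
  rw [h, Finset.mul_sum]
  simp

theorem sum_pair_marginal {i j : ι} (hij : i ≠ j) (g : S i → S j → ℝ) :
    (Fintype.card (S i) * Fintype.card (S j) : ℝ) * ∑ x : ∀ i, S i, g (x i) (x j) =
      Fintype.card (∀ i, S i) * ∑ y, ∑ z, g y z := by
  rw [mul_assoc, ← sum_sum_update j, ← sum_sum_update i]
  simp [Function.update_of_ne hij]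

/-- `φ` ignores coordinate `l`, so resampling it averages `g` alone, where the fiberwise bound
applies. -/
theorem sum_mul_le_of_forall_update {l k : ι} (hkl : k ≠ l) {φ : (∀ i, S i) → ℝ}
    (hφ0 : ∀ x, 0 ≤ φ x) (hφ : ∀ x y, φ (Function.update x l y) = φ x) {η : ℝ}
    {g : S k → S l → ℝ} (hg : ∀ y, ∑ z, g y z ≤ η * Fintype.card (S l)) [Nonempty (S l)] :
    ∑ x, φ x * g (x k) (x l) ≤ η * ∑ x, φ x := by
  have hpos : (0 : ℝ) < Fintype.card (S l) := by exact_mod_cast Fintype.card_pos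
  refine le_of_mul_le_mul_left ?_ hpos
  rw [← sum_sum_update l, mul_left_comm, ← mul_assoc, Finset.mul_sum]
  refine Finset.sum_le_sum fun x _ => ?_
  simp only [hφ, Function.update_of_ne hkl, Function.update_self]
  rw [← Finset.mul_sum, mul_comm (η * _)]
  exact mul_le_mul_of_nonneg_left (hg _) (hφ0 x)

end Probability

/-! ### Bonferroni inequalities and pairwise relations. -/

open Classical in
/-- Bonferroni inequalities for almost independent events of probability close to `ε`. -/
theorem abs_prob_none_sub_le {Ω κ : Type*} [Fintype Ω] [Nonempty Ω] (P : Finset κ)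
    (p : κ → Ω → Prop) {ε δ η : ℝ} (hη : 0 ≤ η)
    (hprob : ∀ e ∈ P, |(∑ x, if p e x then (1 : ℝ) else 0) / Fintype.card Ω - ε| ≤ δ)
    (hjoint : ∀ e ∈ P, ∀ f ∈ P, e ≠ f →
      ∑ x, (if p e x then (1 : ℝ) else 0) * (if p f x then 1 else 0) ≤
        η * ∑ x, if p e x then 1 else 0) :
    |(∑ x, if ∀ e ∈ P, ¬ p e x then (1 : ℝ) else 0) / Fintype.card Ω - (1 - P.card * ε)| ≤
      P.card * δ + (P.card : ℝ) ^ 2 * (η * (ε + δ)) := by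
  obtain ⟨I, hI⟩ : ∃ I : κ → Ω → ℝ, ∀ e x, I e x = if p e x then 1 else 0 := ⟨_, fun _ _ => rfl⟩
  obtain ⟨G, hG⟩ : ∃ G : Ω → ℝ, ∀ x, G x = if ∀ e ∈ P, ¬ p e x then 1 else 0 :=
    ⟨_, fun _ => rfl⟩
  simp only [← hI, ← hG] at hprob hjoint ⊢
  have hI0 : ∀ e x, 0 ≤ I e x := fun e x => by
    rw [hI]
    split_ifs <;> norm_num
  have hII : ∀ e x, I e x * I e x = I e x := fun e x => by
    rw [hI]
    split_ifs <;> norm_num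
  have hG1 : ∀ x, 1 - ∑ e ∈ P, I e x ≤ G x := by
    intro x
    rw [hG]
    split_ifs with hx
    · have := Finset.sum_nonneg fun e (_ : e ∈ P) => hI0 e x
      linarith
    · push Not at hx
      obtain ⟨e, he, hE⟩ := hx
      have h1 := Finset.single_le_sum (f := fun e => I e x) (fun e _ => hI0 e x) he
      have h2 : I e x = 1 := by rw [hI, if_pos hE]
      linarith
  have hG2 : ∀ x, G x ≤ 1 - ∑ e ∈ P, I e x + ∑ e ∈ P, ∑ f ∈ P.erase e, I e x * I f x := by
    intro x
    -- With `s` the number of events that occur, the off-diagonal sum is `s ^ 2 - s`. The upper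
    -- bound is then `(s - 1) ^ 2`, which is nonnegative and equals `1` at `s = 0`.
    have h2 : ∑ e ∈ P, ∑ f ∈ P.erase e, I e x * I f x =
        (∑ e ∈ P, I e x) * (∑ e ∈ P, I e x) - ∑ e ∈ P, I e x := by
      rw [Finset.sum_mul_sum, ← Finset.sum_sub_distrib]
      refine Finset.sum_congr rfl fun e he => ?_
      rw [← Finset.add_sum_erase P _ he, hII]
      ring
    rw [h2, hG]
    split_ifs with hx
    · have h0 : ∑ e ∈ P, I e x = 0 :=
        Finset.sum_eq_zero fun e he => by rw [hI, if_neg (hx e he)]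
      rw [h0]
      norm_num
    · nlinarith [sq_nonneg (∑ e ∈ P, I e x - 1)]
  obtain ⟨c, hc⟩ : ∃ c : ℝ, c = Fintype.card Ω := ⟨_, rfl⟩
  have hΩ : 0 < c := by
    rw [hc]
    exact_mod_cast Fintype.card_pos
  rw [← hc]
  simp only [← hc] at hprob
  have hsum1 : ∑ x : Ω, (1 - ∑ e ∈ P, I e x) = c - ∑ e ∈ P, ∑ x, I e x := by
    rw [Finset.sum_sub_distrib, Finset.sum_comm (s := Finset.univ) (t := P)]
    simp [hc]
  have hlow : c - ∑ e ∈ P, ∑ x, I e x ≤ ∑ x, G x :=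
    hsum1 ▸ Finset.sum_le_sum fun x _ => hG1 x
  have hup : ∑ x, G x ≤ c - ∑ e ∈ P, ∑ x, I e x +
      ∑ e ∈ P, ∑ f ∈ P.erase e, ∑ x, I e x * I f x := by
    refine (Finset.sum_le_sum fun x _ => hG2 x).trans_eq ?_
    rw [Finset.sum_add_distrib, hsum1, Finset.sum_comm (s := Finset.univ) (t := P)]
    refine congrArg _ (Finset.sum_congr rfl fun e _ => ?_)
    rw [Finset.sum_comm]
  have hle : ∀ e ∈ P, ∑ x, I e x ≤ (ε + δ) * c := fun e he => by
    have := (abs_le.1 (hprob e he)).2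
    rw [← div_le_iff₀ hΩ]
    linarith
  have hge : ∀ e ∈ P, (ε - δ) * c ≤ ∑ x, I e x := fun e he => by
    have := (abs_le.1 (hprob e he)).1
    rw [← le_div_iff₀ hΩ]
    linarith
  have hA : ∑ e ∈ P, ∑ x, I e x ≤ P.card * ((ε + δ) * c) := by
    rw [← nsmul_eq_mul]
    exact Finset.sum_le_card_nsmul _ _ _ hle
  have hB : P.card * ((ε - δ) * c) ≤ ∑ e ∈ P, ∑ x, I e x := by
    rw [← nsmul_eq_mul]
    exact Finset.card_nsmul_le_sum _ _ _ hge
  have hC : ∑ e ∈ P, ∑ f ∈ P.erase e, ∑ x, I e x * I f x ≤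
      P.card * (P.card * (η * ((ε + δ) * c))) := by
    rw [← nsmul_eq_mul]
    refine Finset.sum_le_card_nsmul _ _ _ fun e he => ?_
    have h0 : 0 ≤ η * ((ε + δ) * c) := mul_nonneg hη
      ((Finset.sum_nonneg fun x _ => hI0 e x).trans (hle e he))
    refine (Finset.sum_le_card_nsmul _ _ (η * ((ε + δ) * c)) fun f hf => ?_).trans ?_
    · obtain ⟨h1, h2⟩ := Finset.mem_erase.1 hf
      exact (hjoint e he f h2 (Ne.symm h1)).trans (mul_le_mul_of_nonneg_left (hle e he) hη)
    · rw [nsmul_eq_mul]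
      gcongr
      exact Finset.erase_subset _ _
  -- The lower bound has no quadratic term, so the symmetric estimate needs this term to be
  -- nonnegative. No sign of `ε + δ` is assumed; it follows from `hC`.
  have h0 : 0 ≤ P.card * (P.card * (η * ((ε + δ) * c))) := by
    refine le_trans (Finset.sum_nonneg fun e _ => Finset.sum_nonneg fun f _ =>
      Finset.sum_nonneg fun x _ => mul_nonneg (hI0 e x) (hI0 f x)) hC
  have heq : (∑ x, G x) / c - (1 - P.card * ε) = (∑ x, G x - (c - P.card * (ε * c))) / c := by
    field_simp
  rw [heq, abs_div, abs_of_pos hΩ, div_le_iff₀ hΩ, abs_le]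
  constructor <;> linarith

/-- For a family of symmetric relations between independent uniformly distributed variables, each
pair of which is related with probability close to `ε`, the probability that no two variables are
related. -/
theorem abs_prob_pairwise_sub_le {N : ℕ} {S : Fin N → Type*} [∀ i, Finite (S i)]
    [∀ i, Nonempty (S i)] {E : ∀ i j, S i → S j → Prop}
    (hsymm : ∀ i j x y, E i j x y → E j i y x) {ε δ η : ℝ} (hη : 0 ≤ η)
    (hpair : ∀ i j, i ≠ j → |({p : S i × S j | E i j p.1 p.2}.ncard : ℝ) /
      (Nat.card (S i) * Nat.card (S j)) - ε| ≤ δ)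
    (hfib : ∀ i j, i ≠ j → ∀ x, ({y | E i j x y}.ncard : ℝ) ≤ η * Nat.card (S j)) :
    |({x : ∀ i, S i | ∀ i j, i ≠ j → ¬ E i j (x i) (x j)}.ncard : ℝ) / Nat.card (∀ i, S i) -
        (1 - (N : ℝ) * ((N : ℝ) - 1) / 2 * ε)| ≤
      (N : ℝ) * ((N : ℝ) - 1) / 2 * δ +
        ((N : ℝ) * ((N : ℝ) - 1) / 2) ^ 2 * (η * (ε + δ)) := by
  classical
  have := fun i => Fintype.ofFinite (S i)
  simp only [Nat.card_eq_fintype_card, natCast_ncard_setOf] at hpair hfib ⊢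
  rw [← natCast_card_filter_fst_lt_snd]
  set P := Finset.univ.filter fun e : Fin N × Fin N => e.1 < e.2
  let I : Fin N × Fin N → (∀ i, S i) → ℝ := fun e x =>
    if E e.1 e.2 (x e.1) (x e.2) then 1 else 0
  have hI0 : ∀ e x, 0 ≤ I e x := fun e x => by
    dsimp only [I]
    split_ifs <;> norm_num
  have hne : ∀ e ∈ P, e.1 ≠ e.2 := fun e he => (Finset.mem_filter.1 he).2.ne
  have hΩ : (0 : ℝ) < Fintype.card (∀ i, S i) := by exact_mod_cast Fintype.card_pos
  have hS : ∀ i, (0 : ℝ) < Fintype.card (S i) := fun i => by exact_mod_cast Fintype.card_pos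
  have hprob : ∀ e ∈ P, |(∑ x, I e x) / Fintype.card (∀ i, S i) - ε| ≤ δ := by
    intro e he
    have h1 := sum_pair_marginal (hne e he)
      fun (y : S e.1) (z : S e.2) => if E e.1 e.2 y z then (1 : ℝ) else 0
    have h2 := hpair e.1 e.2 (hne e he)
    rw [Fintype.sum_prod_type] at h2
    have h3 : (∑ x, I e x) / Fintype.card (∀ i, S i) =
        (∑ y : S e.1, ∑ z : S e.2, if E e.1 e.2 y z then (1 : ℝ) else 0) /
          (Fintype.card (S e.1) * Fintype.card (S e.2)) := by
      rw [div_eq_div_iff hΩ.ne' (mul_pos (hS _) (hS _)).ne', mul_comm, mul_comm (∑ y, _)]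
      exact h1
    rw [h3]
    exact h2
  have hjoint : ∀ e ∈ P, ∀ f ∈ P, e ≠ f → ∑ x, I e x * I f x ≤ η * ∑ x, I e x := by
    intro e he f hf hef
    have he' := (Finset.mem_filter.1 he).2
    have hf' := (Finset.mem_filter.1 hf).2
    -- Two different increasing pairs: if the larger index of `f` occurs in `e`, then the smaller
    -- one does not. The index absent from `e` is resampled, after a swap by symmetry in the second
    -- case.
    by_cases hl : e.1 ≠ f.2 ∧ e.2 ≠ f.2
    · refine sum_mul_le_of_forall_update (hne f hf) (hI0 e) (fun x y => ?_)
        (g := fun y z => if E f.1 f.2 y z then 1 else 0) fun y => hfib _ _ (hne f hf) y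
      simp only [I, Function.update_of_ne hl.1, Function.update_of_ne hl.2]
    · have hk : e.1 ≠ f.1 ∧ e.2 ≠ f.1 := by
        constructor <;> rintro h
        · refine hl ⟨h ▸ hf'.ne, fun h2 => hef (Prod.ext h h2)⟩
        · refine hl ⟨(he'.trans (h ▸ hf')).ne, h ▸ hf'.ne⟩
      have hswap : ∀ x, I f x = if E f.2 f.1 (x f.2) (x f.1) then 1 else 0 := fun x =>
        if_congr ⟨hsymm _ _ _ _, hsymm _ _ _ _⟩ rfl rfl
      simp only [hswap]
      refine sum_mul_le_of_forall_update (hne f hf).symm (hI0 e) (fun x y => ?_)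
        (g := fun y z => if E f.2 f.1 y z then 1 else 0) fun y => hfib _ _ (hne f hf).symm y
      simp only [I, Function.update_of_ne hk.1, Function.update_of_ne hk.2]
  have hgood : ∀ x : ∀ i, S i, (∀ i j, i ≠ j → ¬ E i j (x i) (x j)) ↔
      ∀ e ∈ P, ¬ E e.1 e.2 (x e.1) (x e.2) := by
    refine fun x => ⟨fun h e he => h _ _ (hne e he), fun h i j hij hE => ?_⟩
    rcases lt_or_gt_of_ne hij with hlt | hlt
    · exact h (i, j) (Finset.mem_filter.2 ⟨Finset.mem_univ _, hlt⟩) hE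
    · exact h (j, i) (Finset.mem_filter.2 ⟨Finset.mem_univ _, hlt⟩) (hsymm _ _ _ _ hE)
  simp only [hgood]
  have hmain := abs_prob_none_sub_le P
    (fun e (x : ∀ i, S i) => E e.1 e.2 (x e.1) (x e.2)) hη
    (fun e he => by convert hprob e he)
    fun e he f hf hef => by convert hjoint e he f hf hef
  convert hmain

/-! ### Asymptotics for pairs as the field grows. -/

section Asymptotics

variable (F : Type*) [Field F] [Fintype F] {m : ℕ}

/-- Normalising by `t ^ (m * n)` makes all counts `1 + O(t)`, uniformly for `n ≤ M`. -/
theorem hermiteSet_density_bounds (hm : 1 ≤ m) {M n : ℕ} (hn : n ≤ M) {t : ℝ}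
    (ht : t = 1 / (Fintype.card F : ℝ)) :
    1 ≤ (hermiteSet F m n).ncard * t ^ (m * n) ∧
      (hermiteSet F m n).ncard * t ^ (m * n) ≤ 1 + ((M : ℝ) + 1) ^ m * t := by
  have hq : (0 : ℝ) < Fintype.card F := by exact_mod_cast Fintype.card_pos
  have hqt : (Fintype.card F : ℝ) ^ (m * n) * t ^ (m * n) = 1 := by
    rw [← mul_pow, ht, mul_one_div_cancel hq.ne', one_pow]
  have ht0 : 0 < t := by rw [ht]; positivity
  have h1 : ((Fintype.card F : ℝ)) ^ (m * n) ≤ (hermiteSet F m n).ncard := by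
    exact_mod_cast pow_le_ncard_hermiteSet F hm n
  have h2 := ncard_hermiteSet_le F hm n
  constructor
  · rw [← hqt]
    gcongr
  · calc ((hermiteSet F m n).ncard : ℝ) * t ^ (m * n)
        ≤ ((Fintype.card F : ℝ) ^ (m * n) * (1 + ((n : ℝ) + 1) ^ m / Fintype.card F)) *
            t ^ (m * n) := by gcongr
      _ = 1 + ((n : ℝ) + 1) ^ m * t := by
        rw [mul_right_comm, hqt, one_mul, ht, mul_one_div]
      _ ≤ _ := by gcongr

theorem ncard_hermiteSet_pos (hm : 1 ≤ m) (n : ℕ) : 0 < (hermiteSet F m n).ncard :=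
  (pow_pos Fintype.card_pos _).trans_le (pow_le_ncard_hermiteSet F hm n)

theorem card_inv_mem_Ioc {t : ℝ} (ht : t = 1 / (Fintype.card F : ℝ)) : 0 < t ∧ t ≤ 1 := by
  have hq : (1 : ℝ) ≤ Fintype.card F := by exact_mod_cast Fintype.card_pos
  rw [ht]
  exact ⟨by positivity, (div_le_one (by positivity)).2 hq⟩

theorem nonCoprime_density_le (hm : 1 ≤ m) {M a b : ℕ} (ha : a ≤ M) (hb : b ≤ M) {t : ℝ}
    (ht : t = 1 / (Fintype.card F : ℝ)) :
    (nonCoprimePairs F m a b).ncard * t ^ (m * (a + b)) ≤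
      t ^ m + M * (1 + ((M : ℝ) + 1) ^ m) ^ 3 * t ^ (m + 1) := by
  obtain ⟨ht0, ht1⟩ := card_inv_mem_Ioc F ht
  set K : ℝ := ((M : ℝ) + 1) ^ m with hK
  have hK0 : 0 ≤ K := by positivity
  set α : ℕ → ℝ := fun n => (hermiteSet F m n).ncard * t ^ (m * n) with hα
  have hα1 : ∀ n ≤ M, α n ≤ 1 + K * t := fun n hn => (hermiteSet_density_bounds F hm hn ht).2
  have hprod : ∀ d ∈ Finset.Icc 1 (min a b), α d * (α (a - d) * α (b - d)) ≤ (1 + K * t) ^ 3 := by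
    intro d hd
    have hd := Finset.mem_Icc.1 hd
    calc α d * (α (a - d) * α (b - d)) ≤ (1 + K * t) * ((1 + K * t) * (1 + K * t)) := by
          gcongr
          · exact hα1 _ (by omega)
          · exact hα1 _ (by omega)
          · exact hα1 _ (by omega)
      _ = _ := by ring
  have hcube : (1 + K * t) ^ 3 ≤ 1 + (1 + K) ^ 3 * t := by
    have h2 : t ^ 2 ≤ t := by nlinarith
    have h3 : t ^ 3 ≤ t := by nlinarith
    have e1 : K ^ 2 * t ^ 2 ≤ K ^ 2 * t := by gcongr
    have e2 : K ^ 3 * t ^ 3 ≤ K ^ 3 * t := by gcongr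
    nlinarith
  have hcube' : (1 + K * t) ^ 3 ≤ (1 + K) ^ 3 := by
    gcongr
    nlinarith
  -- After normalisation the term of index `d` is `t ^ (m * d)` times three factors close to 1. For
  -- `d ≥ 2` it is absorbed in the error since `2 * m ≥ m + 1`.
  have hterm : ∀ d ∈ Finset.Icc 1 (min a b),
      ((hermiteSet F m d).ncard * ((hermiteSet F m (a - d)).ncard *
        (hermiteSet F m (b - d)).ncard) : ℝ) * t ^ (m * (a + b)) ≤
      (if d = 1 then t ^ m else 0) + (1 + K) ^ 3 * t ^ (m + 1) := by
    intro d hd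
    have hd' := Finset.mem_Icc.1 hd
    have hexp : m * (a + b) = m * d + (m * (a - d) + (m * (b - d) + m * d)) := by
      rw [← mul_add, ← mul_add, ← mul_add]
      congr 1
      omega
    have hsplit : ((hermiteSet F m d).ncard * ((hermiteSet F m (a - d)).ncard *
        (hermiteSet F m (b - d)).ncard) : ℝ) * t ^ (m * (a + b)) =
        α d * (α (a - d) * α (b - d)) * t ^ (m * d) := by
      rw [hexp, pow_add, pow_add, pow_add]
      simp only [hα]
      ring
    rw [hsplit]
    split_ifs with h1
    · subst h1
      calc α 1 * (α (a - 1) * α (b - 1)) * t ^ (m * 1)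
          ≤ (1 + (1 + K) ^ 3 * t) * t ^ (m * 1) := by
            gcongr
            exact (hprod 1 hd).trans hcube
        _ = _ := by ring
    · rw [zero_add]
      gcongr ?_ * ?_
      · exact (hprod d hd).trans hcube'
      · refine pow_le_pow_of_le_one ht0.le ht1 ?_
        have : m * 2 ≤ m * d := Nat.mul_le_mul_left _ (by omega)
        omega
  have hle : ((nonCoprimePairs F m a b).ncard : ℝ) ≤ ∑ d ∈ Finset.Icc 1 (min a b),
      ((hermiteSet F m d).ncard * ((hermiteSet F m (a - d)).ncard *
        (hermiteSet F m (b - d)).ncard) : ℝ) := by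
    exact_mod_cast ncard_nonCoprimePairs_le (F := F) (m := m) a b
  calc (nonCoprimePairs F m a b).ncard * t ^ (m * (a + b))
      ≤ (∑ d ∈ Finset.Icc 1 (min a b),
      ((hermiteSet F m d).ncard * ((hermiteSet F m (a - d)).ncard *
        (hermiteSet F m (b - d)).ncard) : ℝ)) * t ^ (m * (a + b)) := by gcongr
    _ ≤ ∑ d ∈ Finset.Icc 1 (min a b), ((if d = 1 then t ^ m else 0) +
        (1 + K) ^ 3 * t ^ (m + 1)) := by
        rw [Finset.sum_mul]
        exact Finset.sum_le_sum hterm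
    _ = (if 1 ∈ Finset.Icc 1 (min a b) then t ^ m else 0) +
        (min a b : ℕ) * ((1 + K) ^ 3 * t ^ (m + 1)) := by
        rw [Finset.sum_add_distrib, Finset.sum_ite_eq', Finset.sum_const, Nat.card_Icc,
          nsmul_eq_mul, Nat.add_sub_cancel]
    _ ≤ t ^ m + M * ((1 + K) ^ 3 * t ^ (m + 1)) := by
        gcongr
        · split_ifs
          · exact le_rfl
          · positivity
        · exact (min_le_left a b).trans ha
    _ = _ := by ring

/-- Both normalised counts in the denominator are at least 1, so dividing by them only decreases the
density. -/
theorem nonCoprime_prob_le (hm : 1 ≤ m) {M a b : ℕ} (ha : a ≤ M) (hb : b ≤ M) {t : ℝ}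
    (ht : t = 1 / (Fintype.card F : ℝ)) :
    ((nonCoprimePairs F m a b).ncard : ℝ) /
        ((hermiteSet F m a).ncard * (hermiteSet F m b).ncard) ≤
      t ^ m + M * (1 + ((M : ℝ) + 1) ^ m) ^ 3 * t ^ (m + 1) := by
  refine le_trans ?_ (nonCoprime_density_le F hm ha hb ht)
  have hA : (0 : ℝ) < (hermiteSet F m a).ncard := by exact_mod_cast ncard_hermiteSet_pos F hm a
  have hB : (0 : ℝ) < (hermiteSet F m b).ncard := by exact_mod_cast ncard_hermiteSet_pos F hm b
  rw [div_le_iff₀ (by positivity), mul_assoc]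
  refine le_mul_of_one_le_right (Nat.cast_nonneg _) ?_
  have h1 := (hermiteSet_density_bounds F hm ha ht).1
  have h2 := (hermiteSet_density_bounds F hm hb ht).1
  calc (1 : ℝ) ≤ ((hermiteSet F m a).ncard * t ^ (m * a)) *
      ((hermiteSet F m b).ncard * t ^ (m * b)) := one_le_mul_of_one_le_of_one_le h1 h2
    _ = _ := by rw [mul_add, pow_add]; ring

/-- Common divisors of degree 1 suffice. In the constant, `1 + M * (1 + K) ^ 3` pays for the
cofactor pairs that are not coprime, and `2 * K` for the two factors `1 + K * t` in the denominator,
where `K = (M + 1) ^ m`. -/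
theorem le_nonCoprime_prob (hm : 1 ≤ m) {M a b : ℕ} (ha : a ≤ M) (hb : b ≤ M) (ha1 : 1 ≤ a)
    (hb1 : 1 ≤ b) {t : ℝ} (ht : t = 1 / (Fintype.card F : ℝ)) :
    t ^ m - (1 + M * (1 + ((M : ℝ) + 1) ^ m) ^ 3 + 2 * ((M : ℝ) + 1) ^ m) * t ^ (m + 1) ≤
      ((nonCoprimePairs F m a b).ncard : ℝ) /
        ((hermiteSet F m a).ncard * (hermiteSet F m b).ncard) := by
  obtain ⟨ht0, ht1⟩ := card_inv_mem_Ioc F ht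
  -- From here on `a` and `b` are the degrees of the cofactors, possibly 0.
  obtain ⟨a, rfl⟩ := Nat.exists_eq_add_of_le' ha1
  obtain ⟨b, rfl⟩ := Nat.exists_eq_add_of_le' hb1
  have hp := nonCoprime_prob_le F hm (Nat.le_of_succ_le ha) (Nat.le_of_succ_le hb) ht
  have hpos : ∀ n, (0 : ℝ) < (hermiteSet F m n).ncard := fun n => by
    exact_mod_cast ncard_hermiteSet_pos F hm n
  have hadd : ((coprimePairs F m a b).ncard : ℝ) + (nonCoprimePairs F m a b).ncard =
      (hermiteSet F m a).ncard * (hermiteSet F m b).ncard := by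
    exact_mod_cast ncard_coprimePairs_add (F := F) (m := m) a b
  have hmul : ((hermiteSet F m 1).ncard : ℝ) * (coprimePairs F m a b).ncard ≤
      (nonCoprimePairs F m (a + 1) (b + 1)).ncard := by
    exact_mod_cast le_ncard_nonCoprimePairs (F := F) (m := m) (a := a + 1) (b := b + 1) le_rfl
      ha1 hb1
  have hbd := fun n (hn : n ≤ M) => hermiteSet_density_bounds F hm hn ht
  set K : ℝ := ((M : ℝ) + 1) ^ m with hK
  have hK0 : 0 ≤ K := by positivity
  set p : ℝ := ((nonCoprimePairs F m a b).ncard : ℝ) /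
    ((hermiteSet F m a).ncard * (hermiteSet F m b).ncard) with hpdef
  have hAB := mul_pos (hpos a) (hpos b)
  have hcop : ((coprimePairs F m a b).ncard : ℝ) =
      (hermiteSet F m a).ncard * (hermiteSet F m b).ncard * (1 - p) := by
    rw [mul_sub, mul_one, hpdef, mul_div_cancel₀ _ hAB.ne']
    linarith
  have hp0 : 0 ≤ p := by positivity
  have hp1 : 0 ≤ 1 - p := by
    by_contra h
    have : ((coprimePairs F m a b).ncard : ℝ) < 0 := by
      rw [hcop]
      exact mul_neg_of_pos_of_neg hAB (not_le.1 h)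
    exact absurd this (not_lt.2 (Nat.cast_nonneg _))
  have hpt : p ≤ (1 + M * (1 + K) ^ 3) * t := by
    have h1 : t ^ m ≤ t := by
      simpa using pow_le_pow_of_le_one ht0.le ht1 hm
    have h2 : t ^ (m + 1) ≤ t := by
      simpa using pow_le_pow_of_le_one ht0.le ht1 (Nat.le_add_left 1 m)
    calc p ≤ t ^ m + M * (1 + K) ^ 3 * t ^ (m + 1) := hp
      _ ≤ t + M * (1 + K) ^ 3 * t := by gcongr
      _ = _ := by ring
  set α : ℕ → ℝ := fun n => (hermiteSet F m n).ncard * t ^ (m * n) with hα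
  have hd1 : (1 : ℝ) ≤ α 1 * (α a * α b) := one_le_mul_of_one_le_of_one_le
    (hbd 1 (ha1.trans ha)).1 (one_le_mul_of_one_le_of_one_le
      (hbd a (Nat.le_of_succ_le ha)).1 (hbd b (Nat.le_of_succ_le hb)).1)
  have hnum : t ^ m * (1 - p) ≤
      (nonCoprimePairs F m (a + 1) (b + 1)).ncard * t ^ (m * (a + 1 + (b + 1))) := by
    calc t ^ m * (1 - p) ≤ (t ^ m * (1 - p)) * (α 1 * (α a * α b)) :=
          le_mul_of_one_le_right (by positivity) hd1
      _ = ((hermiteSet F m 1).ncard * (coprimePairs F m a b).ncard) *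
          t ^ (m * (a + 1 + (b + 1))) := by
          have hexp : m * (a + 1 + (b + 1)) = m + m * 1 + (m * a + m * b) := by ring
          rw [hcop, hexp, pow_add, pow_add, pow_add]
          simp only [hα]
          ring
      _ ≤ _ := by gcongr
  have hden : α (a + 1) * α (b + 1) ≤ (1 + K * t) ^ 2 := by
    rw [sq]
    have h1 := hbd _ ha
    have h2 := hbd _ hb
    exact mul_le_mul h1.2 h2.2 (zero_le_one.trans h2.1) (by positivity)
  have hden0 : 0 < α (a + 1) * α (b + 1) := by
    have := hpos (a + 1)
    have := hpos (b + 1)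
    positivity
  have hfrac : ((nonCoprimePairs F m (a + 1) (b + 1)).ncard : ℝ) /
        ((hermiteSet F m (a + 1)).ncard * (hermiteSet F m (b + 1)).ncard) =
      (nonCoprimePairs F m (a + 1) (b + 1)).ncard * t ^ (m * (a + 1 + (b + 1))) /
        (α (a + 1) * α (b + 1)) := by
    have h1 := (hpos (a + 1)).ne'
    have h2 := (hpos (b + 1)).ne'
    rw [div_eq_div_iff (mul_ne_zero h1 h2) hden0.ne', mul_add, pow_add]
    simp only [hα]
    ring
  rw [hfrac, le_div_iff₀ hden0]
  refine le_trans ?_ hnum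
  set C : ℝ := 1 + M * (1 + K) ^ 3 with hC
  have hfac : t ^ m - (C + 2 * K) * t ^ (m + 1) = t ^ m * (1 - (C + 2 * K) * t) := by ring
  rw [hfac, mul_assoc]
  refine mul_le_mul_of_nonneg_left ?_ (by positivity)
  -- A nonpositive left factor makes the claim trivial; otherwise it reduces to `(1 - (C + 2K)t)(1 +
  -- Kt)^2 ≤ 1 - Ct`, where the terms linear in `K * t` cancel and all remaining corrections are
  -- negative.
  by_cases hneg : 1 - (C + 2 * K) * t ≤ 0
  · exact (mul_nonpos_of_nonpos_of_nonneg hneg hden0.le).trans hp1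
  · have hneg := (not_le.1 hneg).le
    refine (mul_le_mul_of_nonneg_left hden hneg).trans ?_
    have hKt : 0 ≤ K * t := by positivity
    have hCt : 0 ≤ C * t := by positivity
    refine le_trans ?_ (sub_le_sub_left hpt 1)
    nlinarith [mul_nonneg hKt hKt, mul_nonneg hCt hKt, mul_nonneg hKt (mul_nonneg hKt hKt),
      mul_nonneg hCt (mul_nonneg hKt hKt)]

theorem nonCoprime_fiber_le (hm : 1 ≤ m) {M a b : ℕ} (ha : a ≤ M) (hb : b ≤ M) {t : ℝ}
    (ht : t = 1 / (Fintype.card F : ℝ)) {D : Matrix (Fin m) (Fin m) F[X]}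
    (hD : D ∈ hermiteSet F m a) :
    ({E | E ∈ hermiteSet F m b ∧ colModule D ⊔ colModule E ≠ ⊤}.ncard : ℝ) ≤
      (M * ((2 ^ M) ^ m * (1 + ((M : ℝ) + 1) ^ m)) * t) * (hermiteSet F m b).ncard := by
  obtain ⟨ht0, ht1⟩ := card_inv_mem_Ioc F ht
  have hq : (0 : ℝ) < Fintype.card F := by exact_mod_cast Fintype.card_pos
  have hqt : (Fintype.card F : ℝ) * t = 1 := by rw [ht, mul_one_div_cancel hq.ne']
  set K : ℝ := ((M : ℝ) + 1) ^ m with hK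
  have hK0 : 0 ≤ K := by positivity
  have h1 : ({E | E ∈ hermiteSet F m b ∧ colModule D ⊔ colModule E ≠ ⊤}.ncard : ℝ) ≤
      ∑ d ∈ Finset.Icc 1 b, (2 ^ a) ^ m * (Fintype.card F : ℝ) ^ ((m - 1) * d) *
        (hermiteSet F m (b - d)).ncard := by
    have := ncard_nonCoprime_le hD.1.det_ne_zero b
    rw [hD.2] at this
    exact_mod_cast this
  have hterm : ∀ d ∈ Finset.Icc 1 b, ((2 ^ a) ^ m * (Fintype.card F : ℝ) ^ ((m - 1) * d) *
      (hermiteSet F m (b - d)).ncard) * t ^ (m * b) ≤ (2 ^ M) ^ m * (1 + K) * t := by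
    intro d hd
    have hd := Finset.mem_Icc.1 hd
    -- The parts `(m - 1) * d` and `m * (b - d)` normalise the divisors and the cofactors; the
    -- surplus `t ^ d ≤ t` is the gain.
    have hexp : m * b = (m - 1) * d + m * (b - d) + d := by
      obtain ⟨c, rfl⟩ := Nat.exists_eq_add_of_le hd.2
      obtain ⟨k, rfl⟩ := Nat.exists_eq_add_of_le' hm
      simp only [Nat.add_sub_cancel, Nat.add_sub_cancel_left]
      ring
    have hα := (hermiteSet_density_bounds F hm ((Nat.sub_le b d).trans hb) ht).2
    calc ((2 ^ a) ^ m * (Fintype.card F : ℝ) ^ ((m - 1) * d) *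
          (hermiteSet F m (b - d)).ncard) * t ^ (m * b)
        = (2 ^ a) ^ m * ((Fintype.card F : ℝ) * t) ^ ((m - 1) * d) *
          ((hermiteSet F m (b - d)).ncard * t ^ (m * (b - d))) * t ^ d := by
          rw [hexp, pow_add, pow_add, mul_pow]
          ring
      _ = (2 ^ a) ^ m * ((hermiteSet F m (b - d)).ncard * t ^ (m * (b - d))) * t ^ d := by
          rw [hqt, one_pow, mul_one]
      _ ≤ (2 ^ M) ^ m * (1 + K) * t ^ 1 := by
          gcongr ?_ * ?_ * ?_
          · gcongr
            norm_num
          · exact hα.trans (by nlinarith)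
          · exact pow_le_pow_of_le_one ht0.le ht1 hd.1
      _ = _ := by rw [pow_one]
  have htb : 0 < t ^ (m * b) := by positivity
  refine le_of_mul_le_mul_right ?_ htb
  calc ({E | E ∈ hermiteSet F m b ∧ colModule D ⊔ colModule E ≠ ⊤}.ncard : ℝ) * t ^ (m * b)
      ≤ (∑ d ∈ Finset.Icc 1 b, (2 ^ a) ^ m * (Fintype.card F : ℝ) ^ ((m - 1) * d) *
        (hermiteSet F m (b - d)).ncard) * t ^ (m * b) := by gcongr
    _ ≤ b * ((2 ^ M) ^ m * (1 + K) * t) := by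
        rw [Finset.sum_mul]
        refine (Finset.sum_le_card_nsmul _ _ _ hterm).trans_eq ?_
        rw [Nat.card_Icc, Nat.add_sub_cancel, nsmul_eq_mul]
    _ ≤ M * ((2 ^ M) ^ m * (1 + K) * t) := by gcongr
    _ ≤ M * ((2 ^ M) ^ m * (1 + K) * t) * ((hermiteSet F m b).ncard * t ^ (m * b)) :=
        le_mul_of_one_le_right (by positivity) (hermiteSet_density_bounds F hm hb ht).1
    _ = _ := by ring

end Asymptotics

/-! ### From tuples of matrices to a product probability space. -/

section Tuples

variable {F : Type*} [Field F] {m N : ℕ}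

theorem pairwiseLeftCoprime_iff {n : Fin N → ℕ} (D : ∀ i, hermiteSet F m (n i)) :
    PairwiseLeftCoprime (fun i => (D i).1) ↔
      ∀ i j, i ≠ j → ¬ colModule (D i).1 ⊔ colModule (D j).1 ≠ ⊤ := by
  simp only [PairwiseLeftCoprime, leftCoprime_iff_sup_eq_top (D _).2.1.det_ne_zero, not_not]

/-- The probability of pairwise left coprimeness, on the product of the sets of Hermite forms. -/
theorem uniformProb_pairwiseLeftCoprime (n : Fin N → ℕ) :
    uniformProb (hermiteTuples F m n) {D | PairwiseLeftCoprime D} =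
      ({D : ∀ i, hermiteSet F m (n i) | ∀ i j, i ≠ j →
          ¬ colModule (D i).1 ⊔ colModule (D j).1 ≠ ⊤}.ncard : ℝ) /
        Nat.card (∀ i, hermiteSet F m (n i)) := by
  let Φ : (∀ i, hermiteSet F m (n i)) → Fin N → Matrix (Fin m) (Fin m) F[X] :=
    fun D i => (D i).1
  have hΦ : Function.Injective Φ := fun D E h => funext fun i => Subtype.ext (congrFun h i)
  have hX : hermiteTuples F m n = Φ '' Set.univ := by
    ext D
    exact ⟨fun h => ⟨fun i => ⟨D i, h i⟩, trivial, rfl⟩, by rintro ⟨E, -, rfl⟩ i; exact (E i).2⟩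
  have hXS : hermiteTuples F m n ∩ {D | PairwiseLeftCoprime D} =
      Φ '' {D | ∀ i j, i ≠ j → ¬ colModule (D i).1 ⊔ colModule (D j).1 ≠ ⊤} := by
    ext D
    constructor
    · rintro ⟨h, hD⟩
      exact ⟨fun i => ⟨D i, h i⟩, (pairwiseLeftCoprime_iff _).1 hD, rfl⟩
    · rintro ⟨E, hE, rfl⟩
      exact ⟨fun i => (E i).2, (pairwiseLeftCoprime_iff E).2 hE⟩
  rw [uniformProb, hXS, hX, Set.ncard_image_of_injective _ hΦ, Set.ncard_image_of_injective _ hΦ,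
    Set.ncard_univ]

theorem ncard_nonCoprimePairs_subtype (a b : ℕ) :
    {p : hermiteSet F m a × hermiteSet F m b |
        colModule p.1.1 ⊔ colModule p.2.1 ≠ ⊤}.ncard = (nonCoprimePairs F m a b).ncard := by
  refine Set.ncard_congr (fun p _ => (p.1.1, p.2.1)) (fun p hp => ⟨p.1.2, p.2.2, hp⟩) ?_ ?_
  · rintro ⟨D, E⟩ ⟨D', E'⟩ - - h
    exact Prod.ext (Subtype.ext (Prod.mk.inj h).1) (Subtype.ext (Prod.mk.inj h).2)
  · rintro ⟨D, E⟩ ⟨hD, hE, h⟩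
    exact ⟨(⟨D, hD⟩, ⟨E, hE⟩), h, rfl⟩

theorem ncard_nonCoprime_subtype (D : Matrix (Fin m) (Fin m) F[X]) (b : ℕ) :
    {E : hermiteSet F m b | colModule D ⊔ colModule E.1 ≠ ⊤}.ncard =
      {E | E ∈ hermiteSet F m b ∧ colModule D ⊔ colModule E ≠ ⊤}.ncard :=
  Set.ncard_congr (fun E _ => E.1) (fun E hE => ⟨E.2, hE⟩) (fun _ _ _ _ h => Subtype.ext h)
    fun E hE => ⟨⟨E, hE.1⟩, hE.2, rfl⟩

end Tuples

/-! ### The probability of pairwise left coprimeness. -/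

theorem mainTheorem8 (m : ℕ) (hm : 1 ≤ m) (N : ℕ) (n : Fin N → ℕ) (hn : ∀ i, 1 ≤ n i) :
    ∃ C : ℝ, ∀ (F : Type*) [Field F] [Fintype F] (t : ℝ), t = 1 / (Fintype.card F : ℝ) →
      |uniformProb (hermiteTuples F m n) {D | PairwiseLeftCoprime D} -
          (1 - (N : ℝ) * ((N : ℝ) - 1) / 2 * t ^ m)| ≤ C * t ^ (m + 1) := by
  -- Any common bound for the degrees would do; `A` is the error constant for pairs, `B` the one for
  -- fibers.
  set M : ℕ := ∑ i, n i
  have hnM : ∀ i, n i ≤ M := fun i =>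
    Finset.single_le_sum (f := n) (fun _ _ => Nat.zero_le _) (Finset.mem_univ i)
  set A : ℝ := 1 + M * (1 + ((M : ℝ) + 1) ^ m) ^ 3 + 2 * ((M : ℝ) + 1) ^ m with hA
  set B : ℝ := M * ((2 ^ M) ^ m * (1 + ((M : ℝ) + 1) ^ m)) with hB
  have hA0 : 0 ≤ A := by positivity
  have hB0 : 0 ≤ B := by positivity
  refine ⟨(N : ℝ) * ((N : ℝ) - 1) / 2 * A +
    ((N : ℝ) * ((N : ℝ) - 1) / 2) ^ 2 * (B * (1 + A)), fun F _ _ t ht => ?_⟩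
  obtain ⟨ht0, ht1⟩ := card_inv_mem_Ioc F ht
  have hfin : ∀ i, Finite (hermiteSet F m (n i)) := fun i => (hermiteSet_finite F m (n i))
  have hne : ∀ i, Nonempty (hermiteSet F m (n i)) := fun i =>
    (Set.nonempty_of_ncard_ne_zero (ncard_hermiteSet_pos F hm (n i)).ne').to_subtype
  have key := abs_prob_pairwise_sub_le (S := fun i => hermiteSet F m (n i))
    (E := fun i j D E => colModule D.1 ⊔ colModule E.1 ≠ ⊤) (ε := t ^ m)
    (δ := A * t ^ (m + 1)) (η := B * t) (fun i j D E h => by rwa [sup_comm]) (by positivity)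
    (fun i j _ => ?_) (fun i j _ D => ?_)
  · rw [uniformProb_pairwiseLeftCoprime]
    refine key.trans ?_
    have h1 : B * t * (t ^ m + A * t ^ (m + 1)) ≤ B * (1 + A) * t ^ (m + 1) := by
      have h2 : t ^ (m + 1) ≤ t ^ m := pow_le_pow_of_le_one ht0.le ht1 (Nat.le_succ m)
      calc B * t * (t ^ m + A * t ^ (m + 1)) ≤ B * t * (t ^ m + A * t ^ m) := by gcongr
        _ = _ := by ring
    calc _ ≤ (N : ℝ) * ((N : ℝ) - 1) / 2 * (A * t ^ (m + 1)) +
          ((N : ℝ) * ((N : ℝ) - 1) / 2) ^ 2 * (B * (1 + A) * t ^ (m + 1)) := by gcongr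
      _ = _ := by ring
  · rw [ncard_nonCoprimePairs_subtype, Nat.card_coe_set_eq, Nat.card_coe_set_eq, abs_le]
    have h1 := le_nonCoprime_prob F hm (hnM i) (hnM j) (hn i) (hn j) ht
    have h2 := nonCoprime_prob_le F hm (hnM i) (hnM j) ht
    constructor
    · linarith
    · have h3 : M * (1 + ((M : ℝ) + 1) ^ m) ^ 3 ≤ A := by
        have : 0 ≤ ((M : ℝ) + 1) ^ m := by positivity
        rw [hA]
        linarith
      have h4 := mul_le_mul_of_nonneg_right h3 (pow_nonneg ht0.le (m + 1))
      linarith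
  · rw [ncard_nonCoprime_subtype, Nat.card_coe_set_eq]
    exact nonCoprime_fiber_le F hm (hnM i) (hnM j) ht D.2
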